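/- Let $n\in\mathbf N$, $m=2n$, $s>1$. For $k\in\mathbf N$ let $\mathcal G^s_b(\mathbf R^k)$ be the space of all $u\in C^\infty(\mathbf R^k)$ (complex valued) for which there are $A,C>0$ with $|\partial^\alpha u(x)|\le A\,C^{|\alpha|}(\alpha!)^s$ for all $\alpha\in\mathbf N^k$, $x\in\mathbf R^k$, and let $\mathcal G^s_0(\mathbf R^k)=\mathcal G^s_b(\mathbf R^k)\cap C_0^\infty(\mathbf R^k)$. Let $\sigma((y,\eta),(z,\zeta))=\eta\cdot z-y\cdot\zeta$ be the standard symplectic form on $\mathbf R^m=\mathbf R^n\times\mathbf R^n$. Let $a,b\in\mathcal G^s_b(\mathbf R^m)$, and let $\chi\in\mathcal G^s_0(\mathbf R^{2m})$ be such that $\chi(Y,Z)=1$ for $|(Y,Z)|\le 1$ and $\operatorname{supp}\chi\subset B(0,2)$ (open Euclidean ball). For $0<h\le 1$ and $X\in\mathbf R^m$ set $$r_\chi(X)=r_\chi(X;h)=\frac1{(\pi h)^m}\iint_{\mathbf R^m\times\mathbf R^m}e^{-2i\sigma(Y,Z)/h}\,(1-\chi(Y,Z))\,a(X+Y)\,b(X+Z)\,dY\,dZ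 ,$$ where the integral is an oscillatory one: it is the limit, as $\varepsilon\to0^+$, of the absolutely convergent integrals obtained by inserting the factor $\psi(\varepsilon Y,\varepsilon Z)$, for any $\psi\in\mathcal S(\mathbf R^{2m})$ with $\psi(0)=1$, the limit being the same for all such $\psi$. Then, for all $h\in(0,1]$ and $X\in\mathbf R^m$, this oscillatory integral exists; $r_\chi(\cdot\,;h)\in C^\infty(\mathbf R^m)$ for all $h\in(0,1]$; and there exists $C>0$ (independent of $h$, $\alpha$, $X$) such that for all $\alpha\in\mathbf N^m$, $h\in(0,1]$ and $X\in\mathbf R^m$, $$|\partial^\alpha r_\chi(X;h)|\le C^{1+|\alpha|}(\alpha!)^s\exp\left(-\tfrac1C\,h^{-1/s}\right).$$ -/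

import Mathlib

open scoped ContDiff

noncomputable section

namespace GevreyMoyal

/-- `ℝᵏ` with its Euclidean norm and Lebesgue measure. -/
abbrev E (k : ℕ) : Type := EuclideanSpace ℝ (Fin k)

/-- The length `|α| = α₁ + ⋯ + α_k` of a multi-index. -/
def multiLength {k : ℕ} (α : Fin k → ℕ) : ℕ := ∑ i, α i

/-- The factorial `α! = α₁! ⋯ α_k!` of a multi-index. -/
def multiFactorial {k : ℕ} (α : Fin k → ℕ) : ℕ := ∏ i, (α i).factorial

/-- The partial derivative `∂^α u (x)` of a smooth function: the derivative of order `|α|` of `u`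
at `x`, evaluated on the tuple in which each basis vector `e_i` is listed `α i` times (the tuple is
`e₀, …, e₀, e₁, …, e₁, …`). -/
def multiDeriv {k : ℕ} (α : Fin k → ℕ) (u : E k → ℂ) (x : E k) : ℂ :=
  iteratedFDeriv ℝ (∑ i, α i) u x
    (fun j => EuclideanSpace.single (finSigmaFinEquiv.symm j).1 (1 : ℝ))

/-- The global Gevrey class `𝒢ˢ_b(ℝᵏ)`. -/
def IsGevreyBounded {k : ℕ} (s : ℝ) (u : E k → ℂ) : Prop :=
  ContDiff ℝ ∞ u ∧ ∃ A > (0 : ℝ), ∃ C > (0 : ℝ), ∀ (α : Fin k → ℕ) (x : E k),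
    ‖multiDeriv α u x‖ ≤ A * C ^ multiLength α * (multiFactorial α : ℝ) ^ s

/-- The class `𝒢ˢ_0(ℝᵏ)` of compactly supported Gevrey functions. -/
def IsGevreyCompact {k : ℕ} (s : ℝ) (u : E k → ℂ) : Prop :=
  IsGevreyBounded s u ∧ HasCompactSupport u

/-- `I` is the value of the oscillatory integral `∫ e^{iφ(w)} f(w) dw`: for every Schwartz function
`ψ` with `ψ(0) = 1`, the integrals regularized by the factor `ψ(εw)` are absolutely convergent and
tend to `I` as `ε → 0⁺`. -/
def HasOscillatoryIntegral {k : ℕ} (φ : E k → ℝ) (f : E k → ℂ) (I : ℂ) : Prop :=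
  ∀ ψ : SchwartzMap (E k) ℂ, ψ 0 = 1 →
    (∀ ε : ℝ, 0 < ε → MeasureTheory.Integrable
      (fun w : E k => Complex.exp (Complex.I * (φ w : ℂ)) * ψ (ε • w) * f w)) ∧
    Filter.Tendsto
      (fun ε : ℝ => ∫ w : E k, Complex.exp (Complex.I * (φ w : ℂ)) * ψ (ε • w) * f w)
      (nhdsWithin 0 (Set.Ioi 0)) (nhds I)

/-- The value of an oscillatory integral is unique. -/
theorem HasOscillatoryIntegral.unique {k : ℕ} {φ : E k → ℝ} {f : E k → ℂ} {I J : ℂ}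
    (hI : HasOscillatoryIntegral φ f I) (hJ : HasOscillatoryIntegral φ f J) : I = J := by
  obtain ⟨ψ, hψ⟩ : ∃ ψ : SchwartzMap (E k) ℂ, ψ 0 = 1 := by
    let g : ContDiffBump (0 : E k) := ⟨1, 2, one_pos, one_lt_two⟩
    have h1 : HasCompactSupport (fun x => ((g x : ℝ) : ℂ)) :=
      g.hasCompactSupport.comp_left (g := fun t : ℝ => (t : ℂ)) Complex.ofReal_zero
    have h2 : ContDiff ℝ ∞ (fun x => ((g x : ℝ) : ℂ)) :=
      Complex.ofRealCLM.contDiff.comp g.contDiff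
    refine ⟨h1.toSchwartzMap h2, ?_⟩
    simp [g.one_of_mem_closedBall (x := 0) (by simp [g.rIn_pos.le])]
  exact tendsto_nhds_unique (hI ψ hψ).2 (hJ ψ hψ).2

open Classical in
/-- The value of the oscillatory integral `∫ e^{iφ(w)} f(w) dw` (zero if it does not exist). -/
def oscillatoryIntegral {k : ℕ} (φ : E k → ℝ) (f : E k → ℂ) : ℂ :=
  if h : ∃ I, HasOscillatoryIntegral φ f I then h.choose else 0

/-- The component `Y` of `W = (Y, Z) ∈ ℝᵏ × ℝᵏ = ℝ²ᵏ`. -/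
def fstHalf {k : ℕ} (W : E (k + k)) : E k := WithLp.toLp 2 (fun i => W (Fin.castAdd k i))

/-- The component `Z` of `W = (Y, Z) ∈ ℝᵏ × ℝᵏ = ℝ²ᵏ`. -/
def sndHalf {k : ℕ} (W : E (k + k)) : E k := WithLp.toLp 2 (fun i => W (Fin.natAdd k i))

/-- The standard symplectic form `σ((y,η),(z,ζ)) = η·z - y·ζ` on `ℝ²ⁿ = ℝⁿ × ℝⁿ`. -/
def sympl {n : ℕ} (Y Z : E (n + n)) : ℝ :=
  inner ℝ (sndHalf Y) (fstHalf Z) - inner ℝ (fstHalf Y) (sndHalf Z)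

/-- The phase `-2σ(Y,Z)/h`, as a function of `W = (Y,Z)`. -/
def moyalPhase {n : ℕ} (h : ℝ) (W : E ((n + n) + (n + n))) : ℝ :=
  -2 * sympl (fstHalf W) (sndHalf W) / h

/-- The amplitude `(1 - χ(Y,Z)) a(X+Y) b(X+Z)`, as a function of `W = (Y,Z)`. -/
def offDiagAmplitude {n : ℕ} (χ : E ((n + n) + (n + n)) → ℂ) (a b : E (n + n) → ℂ)
    (X : E (n + n)) (W : E ((n + n) + (n + n))) : ℂ :=
  (1 - χ W) * a (X + fstHalf W) * b (X + sndHalf W)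

/-- `r_χ(X) = (πh)^{-m} ∬ e^{-2iσ(Y,Z)/h} (1 - χ(Y,Z)) a(X+Y) b(X+Z) dY dZ`, `m = 2n`, as an
oscillatory integral. -/
def rChi {n : ℕ} (χ : E ((n + n) + (n + n)) → ℂ) (a b : E (n + n) → ℂ) (h : ℝ)
    (X : E (n + n)) : ℂ :=
  (((Real.pi * h) ^ (n + n) : ℝ) : ℂ)⁻¹ *
    oscillatoryIntegral (moyalPhase h) (offDiagAmplitude χ a b X)

end GevreyMoyal

end

open scoped ContDiff
open GevreyMoyal

/-! The phase `φ = -2σ(Y,Z)/h` is a nondegenerate bilinear form, so each coordinate `W i` of `W =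
(Y,Z)` has a fixed direction `v i` of norm at most 1, with zero `i`-th component, along which `φ`
has derivative `W i / h` (`exists_coord_direction`). Hence multiplying by `W i` under the integral
amounts to applying `i h ∂_{v i}` to the amplitude.

Existence: writing `1 = (W i + i) / (W i + i)` and integrating by parts twice in every coordinate
yields an absolutely convergent integral `oscVal`. It contains no regularizing factor, and the
regularized integrals converge to it by dominated convergence
(`IsCoordPhase.hasOscillatoryIntegral`). It is controlled by finitely many derivatives of the
amplitude, uniformly in `0 < h ≤ 1`, so a Taylor expansion in the parameter `X` allows
differentiation under the integral sign (`IsCoordPhase.contDiff_oscParam`).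

Decay: `1 - χ` vanishes on the unit ball, so an ordered partition splits the amplitude into pieces,
the `i`-th of which vanishes where `W i` is small (`sum_amplitudePiece`). On such a piece one may
divide by `W i` as often as desired. As `∂_{v i}` annihilates functions of `W i`, the `N`
derivatives fall only on the Gevrey amplitude, and `N` integrations by parts gain a factor `D ^ N *
N! ^ s * h ^ N` (`GevreyBdd.exists_norm_oscParam_le`). Taking `N` of size `h ^ (-1/s)` makes this
exponentially small, and a fraction of the exponential absorbs the prefactor `h ^ (-m)`
(`exists_pow_mul_factorial_rpow_le`). The `X`-derivatives also fall on the amplitude and cost `|α|!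
^ s`, comparable to `α! ^ s` up to a geometric factor. -/

namespace GevreyMoyal

/-! ### Jet norms and functions with bounded derivatives. -/

section Jet

variable {V : Type*} [NormedAddCommGroup V] [NormedSpace ℝ V]

/-- The sum of the norms of the derivatives of `f` at `x` of order at most `K`. -/
noncomputable def jetNorm (K : ℕ) (f : V → ℂ) (x : V) : ℝ :=
  ∑ k ∈ Finset.range (K + 1), ‖iteratedFDeriv ℝ k f x‖

/-- The directional derivative of `f` along a fixed vector, as a function of the point. -/
noncomputable def dirDeriv (v : V) (f : V → ℂ) (x : V) : ℂ := fderiv ℝ f x v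

/-- Smooth functions all of whose derivatives are bounded. -/
def SmoothBdd (f : V → ℂ) : Prop :=
  ContDiff ℝ ∞ f ∧ ∀ K : ℕ, ∃ M : ℝ, ∀ x, jetNorm K f x ≤ M

theorem jetNorm_nonneg (K : ℕ) (f : V → ℂ) (x : V) : 0 ≤ jetNorm K f x :=
  Finset.sum_nonneg fun _ _ => norm_nonneg _

theorem norm_iteratedFDeriv_le_jetNorm {k K : ℕ} (hk : k ≤ K) (f : V → ℂ) (x : V) :
    ‖iteratedFDeriv ℝ k f x‖ ≤ jetNorm K f x :=
  Finset.single_le_sum (f := fun k => ‖iteratedFDeriv ℝ k f x‖) (fun _ _ => norm_nonneg _)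
    (Finset.mem_range.2 (by lia))

theorem norm_le_jetNorm (K : ℕ) (f : V → ℂ) (x : V) : ‖f x‖ ≤ jetNorm K f x := by
  simpa using norm_iteratedFDeriv_le_jetNorm (Nat.zero_le K) f x

theorem jetNorm_mono {K L : ℕ} (h : K ≤ L) (f : V → ℂ) (x : V) : jetNorm K f x ≤ jetNorm L f x :=
  Finset.sum_le_sum_of_subset_of_nonneg (Finset.range_mono (by lia)) fun _ _ _ => norm_nonneg _

theorem jetNorm_le_of_forall {K : ℕ} {f : V → ℂ} {x : V} {M : ℝ}
    (h : ∀ k ≤ K, ‖iteratedFDeriv ℝ k f x‖ ≤ M) : jetNorm K f x ≤ (K + 1) * M := by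
  refine (Finset.sum_le_card_nsmul _ _ M fun k hk => h k ?_).trans ?_
  · have := Finset.mem_range.1 hk; lia
  · simp

theorem jetNorm_sub_le {f g : V → ℂ} (hf : ContDiff ℝ ∞ f) (hg : ContDiff ℝ ∞ g) (K : ℕ) (x : V) :
    jetNorm K (fun y => f y - g y) x ≤ jetNorm K f x + jetNorm K g x := by
  rw [jetNorm, jetNorm, jetNorm, ← Finset.sum_add_distrib]
  refine Finset.sum_le_sum fun k _ => ?_
  have : iteratedFDeriv ℝ k (fun y => f y - g y) x
      = iteratedFDeriv ℝ k f x - iteratedFDeriv ℝ k g x :=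
    iteratedFDeriv_sub_apply (hf.contDiffAt.of_le (mod_cast le_top))
      (hg.contDiffAt.of_le (mod_cast le_top))
  rw [this]
  exact norm_sub_le _ _

theorem jetNorm_add_le {f g : V → ℂ} (hf : ContDiff ℝ ∞ f) (hg : ContDiff ℝ ∞ g) (K : ℕ) (x : V) :
    jetNorm K (fun y => f y + g y) x ≤ jetNorm K f x + jetNorm K g x := by
  rw [jetNorm, jetNorm, jetNorm, ← Finset.sum_add_distrib]
  refine Finset.sum_le_sum fun k _ => ?_
  have : iteratedFDeriv ℝ k (fun y => f y + g y) x
      = iteratedFDeriv ℝ k f x + iteratedFDeriv ℝ k g x :=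
    iteratedFDeriv_add_apply (hf.contDiffAt.of_le (mod_cast le_top))
      (hg.contDiffAt.of_le (mod_cast le_top))
  rw [this]
  exact norm_add_le _ _

theorem jetNorm_mul_le {f g : V → ℂ} (hf : ContDiff ℝ ∞ f) (hg : ContDiff ℝ ∞ g) (K : ℕ) (x : V) :
    jetNorm K (fun y => f y * g y) x ≤ 2 ^ (K + 1) * (jetNorm K f x * jetNorm K g x) := by
  have key : ∀ k ∈ Finset.range (K + 1), ‖iteratedFDeriv ℝ k (fun y => f y * g y) x‖
      ≤ 2 ^ k * (jetNorm K f x * jetNorm K g x) := by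
    intro k hk
    have hk := Finset.mem_range.1 hk
    refine (norm_iteratedFDeriv_mul_le hf hg x (n := k) (mod_cast le_top)).trans ?_
    have h2 : (2 : ℝ) ^ k = ∑ i ∈ Finset.range (k + 1), (k.choose i : ℝ) := by
      exact_mod_cast (Nat.sum_range_choose k).symm
    rw [h2, Finset.sum_mul]
    refine Finset.sum_le_sum fun i hi => ?_
    have hi := Finset.mem_range.1 hi
    rw [mul_assoc]
    gcongr
    · exact jetNorm_nonneg _ _ _
    · exact norm_iteratedFDeriv_le_jetNorm (by lia) f x
    · exact norm_iteratedFDeriv_le_jetNorm (by lia) g x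
  refine (Finset.sum_le_sum key).trans ?_
  rw [← Finset.sum_mul]
  have h0 := mul_nonneg (jetNorm_nonneg K f x) (jetNorm_nonneg K g x)
  gcongr
  have := Nat.geomSum_lt (m := 2) (n := K + 1) (s := Finset.range (K + 1)) le_rfl
    (fun k hk => Finset.mem_range.1 hk)
  exact_mod_cast this.le

theorem dirDeriv_contDiff {f : V → ℂ} (hf : ContDiff ℝ ∞ f) (v : V) :
    ContDiff ℝ ∞ (dirDeriv v f) :=
  (hf.fderiv_right (m := ∞) (by simp)).clm_apply contDiff_const

theorem norm_iteratedFDeriv_dirDeriv_le {f : V → ℂ} (hf : ContDiff ℝ ∞ f) (v : V) (k : ℕ) (x : V) :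
    ‖iteratedFDeriv ℝ k (dirDeriv v f) x‖ ≤ ‖v‖ * ‖iteratedFDeriv ℝ (k + 1) f x‖ := by
  have := norm_iteratedFDeriv_clm_apply_const (𝕜 := ℝ) (f := fderiv ℝ f) (c := v) (x := x)
    (N := ∞) (n := k) (hf.fderiv_right (m := ∞) (by simp)).contDiffAt (mod_cast le_top)
  rwa [norm_iteratedFDeriv_fderiv] at this

theorem jetNorm_dirDeriv_le {f : V → ℂ} (hf : ContDiff ℝ ∞ f) (v : V) (K : ℕ) (x : V) :
    jetNorm K (dirDeriv v f) x ≤ ‖v‖ * jetNorm (K + 1) f x := by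
  have h1 : jetNorm (K + 1) f x
      = (∑ k ∈ Finset.range (K + 1), ‖iteratedFDeriv ℝ (k + 1) f x‖) + ‖f x‖ := by
    rw [jetNorm, Finset.sum_range_succ']; simp
  calc jetNorm K (dirDeriv v f) x
      ≤ ∑ k ∈ Finset.range (K + 1), ‖v‖ * ‖iteratedFDeriv ℝ (k + 1) f x‖ :=
        Finset.sum_le_sum fun k _ => norm_iteratedFDeriv_dirDeriv_le hf v k x
    _ = ‖v‖ * ∑ k ∈ Finset.range (K + 1), ‖iteratedFDeriv ℝ (k + 1) f x‖ := by
        rw [Finset.mul_sum]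
    _ ≤ _ := by rw [h1]; gcongr; linarith [norm_nonneg (f x)]

theorem jetNorm_continuous {f : V → ℂ} (hf : ContDiff ℝ ∞ f) (K : ℕ) : Continuous (jetNorm K f) :=
  continuous_finsetSum _ fun _ _ => (hf.continuous_iteratedFDeriv (mod_cast le_top)).norm

theorem jetNorm_const (K : ℕ) (c : ℂ) (x : V) : jetNorm K (fun _ => c) x = ‖c‖ := by
  rw [jetNorm, Finset.sum_range_succ', Finset.sum_eq_zero]
  · simp
  · intro k _
    rw [iteratedFDeriv_const_of_ne (by lia)]
    simp

theorem jetNorm_const_mul {f : V → ℂ} (hf : ContDiff ℝ ∞ f) (c : ℂ) (K : ℕ) (x : V) :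
    jetNorm K (fun y => c * f y) x = ‖c‖ * jetNorm K f x := by
  rw [jetNorm, jetNorm, Finset.mul_sum]
  refine Finset.sum_congr rfl fun k _ => ?_
  have : iteratedFDeriv ℝ k (fun y => c * f y) x = c • iteratedFDeriv ℝ k f x :=
    iteratedFDeriv_const_smul_apply (a := c) (f := f)
      (hf.contDiffAt.of_le (mod_cast le_top) : ContDiffAt ℝ k f x)
  rw [this, norm_smul]

theorem dirDeriv_mul {f g : V → ℂ} (hf : ContDiff ℝ ∞ f) (hg : ContDiff ℝ ∞ g) (v x : V) :
    dirDeriv v (fun y => f y * g y) x = dirDeriv v f x * g x + f x * dirDeriv v g x := by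
  have h1 := (hf.differentiable (by simp)).differentiableAt (x := x)
  have h2 := (hg.differentiable (by simp)).differentiableAt (x := x)
  simp only [dirDeriv]
  rw [fderiv_fun_mul h1 h2]
  simp; ring

theorem dirDeriv_sub {f g : V → ℂ} (hf : ContDiff ℝ ∞ f) (hg : ContDiff ℝ ∞ g) (v x : V) :
    dirDeriv v (fun y => f y - g y) x = dirDeriv v f x - dirDeriv v g x := by
  have h1 := (hf.differentiable (by simp)).differentiableAt (x := x)
  have h2 := (hg.differentiable (by simp)).differentiableAt (x := x)
  simp only [dirDeriv]
  rw [fderiv_fun_sub h1 h2]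
  simp

theorem dirDeriv_const_mul {f : V → ℂ} (hf : ContDiff ℝ ∞ f) (c : ℂ) (v x : V) :
    dirDeriv v (fun y => c * f y) x = c * dirDeriv v f x := by
  have h1 := (hf.differentiable (by simp)).differentiableAt (x := x)
  simp only [dirDeriv]
  rw [fderiv_const_mul h1]
  simp

namespace SmoothBdd

theorem exists_bound {f : V → ℂ} (hf : SmoothBdd f) (K : ℕ) :
    ∃ M : ℝ, 0 ≤ M ∧ ∀ x, jetNorm K f x ≤ M := by
  obtain ⟨M, hM⟩ := hf.2 K
  exact ⟨max M 0, le_max_right _ _, fun x => (hM x).trans (le_max_left _ _)⟩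

theorem const (c : ℂ) : SmoothBdd (fun _ : V => c) :=
  ⟨contDiff_const, fun K => ⟨‖c‖, fun x => (jetNorm_const K c x).le⟩⟩

theorem mul {f g : V → ℂ} (hf : SmoothBdd f) (hg : SmoothBdd g) :
    SmoothBdd (fun x => f x * g x) := by
  refine ⟨hf.1.mul hg.1, fun K => ?_⟩
  obtain ⟨M, hM0, hM⟩ := hf.exists_bound K
  obtain ⟨N, hN0, hN⟩ := hg.exists_bound K
  refine ⟨2 ^ (K + 1) * (M * N), fun x => (jetNorm_mul_le hf.1 hg.1 K x).trans ?_⟩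
  gcongr
  · exact jetNorm_nonneg _ _ _
  · exact hM x
  · exact hN x

theorem add {f g : V → ℂ} (hf : SmoothBdd f) (hg : SmoothBdd g) :
    SmoothBdd (fun x => f x + g x) := by
  refine ⟨hf.1.add hg.1, fun K => ?_⟩
  obtain ⟨M, hM⟩ := hf.2 K
  obtain ⟨N, hN⟩ := hg.2 K
  exact ⟨M + N, fun x => (jetNorm_add_le hf.1 hg.1 K x).trans (add_le_add (hM x) (hN x))⟩

theorem sub {f g : V → ℂ} (hf : SmoothBdd f) (hg : SmoothBdd g) :
    SmoothBdd (fun x => f x - g x) := by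
  refine ⟨hf.1.sub hg.1, fun K => ?_⟩
  obtain ⟨M, hM⟩ := hf.2 K
  obtain ⟨N, hN⟩ := hg.2 K
  exact ⟨M + N, fun x => (jetNorm_sub_le hf.1 hg.1 K x).trans (add_le_add (hM x) (hN x))⟩

theorem const_mul {f : V → ℂ} (hf : SmoothBdd f) (c : ℂ) : SmoothBdd (fun x => c * f x) :=
  (const c).mul hf

theorem dirDeriv {f : V → ℂ} (hf : SmoothBdd f) (v : V) : SmoothBdd (dirDeriv v f) := by
  refine ⟨dirDeriv_contDiff hf.1 v, fun K => ?_⟩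
  obtain ⟨M, hM⟩ := hf.2 (K + 1)
  exact ⟨‖v‖ * M, fun x => (jetNorm_dirDeriv_le hf.1 v K x).trans
    (mul_le_mul_of_nonneg_left (hM x) (norm_nonneg v))⟩

theorem pow {f : V → ℂ} (hf : SmoothBdd f) (N : ℕ) : SmoothBdd (fun x => f x ^ N) := by
  induction N with
  | zero => simpa using const 1
  | succ N ih => simpa only [pow_succ] using ih.mul hf

end SmoothBdd

/-- With the number of derivatives fixed, a power costs only a geometric factor in `N`. This is what
lets the `N`-th power of the reciprocal of a coordinate enter the final bound without an additional
factorial. -/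
theorem jetNorm_pow_le {f : V → ℂ} (hf : ContDiff ℝ ∞ f) {K : ℕ} {x : V} {M : ℝ}
    (hM : jetNorm K f x ≤ M) (N : ℕ) :
    jetNorm K (fun y => f y ^ N) x ≤ (2 ^ (K + 1) * M) ^ N := by
  induction N with
  | zero => simp [jetNorm_const]
  | succ N ih =>
    simp only [pow_succ _ N]
    refine (jetNorm_mul_le (hf.pow N) hf K x).trans ?_
    have h0 := jetNorm_nonneg K f x
    have h1 : 0 ≤ M := h0.trans hM
    rw [mul_left_comm]
    gcongr

/-- Composition with an affine map. -/
theorem norm_iteratedFDeriv_comp_affine_le {U : Type*} [NormedAddCommGroup U] [NormedSpace ℝ U]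
    {f : V → ℂ} (hf : ContDiff ℝ ∞ f) (g : U →L[ℝ] V) (p : V) (k : ℕ) (x : U) :
    ‖iteratedFDeriv ℝ k (fun y => f (p + g y)) x‖
      ≤ ‖iteratedFDeriv ℝ k f (p + g x)‖ * ‖g‖ ^ k := by
  have h1 : ContDiff ℝ ∞ (fun y : V => f (p + y)) := 
    hf.comp ((contDiff_const (c := p)).add contDiff_id)
  have h2 := g.iteratedFDeriv_comp_right (f := fun y : V => f (p + y)) h1 x (i := k)
    (mod_cast le_top)
  have h3 : (fun y => f (p + g y)) = (fun y : V => f (p + y)) ∘ g := rfl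
  rw [h3, h2, iteratedFDeriv_comp_add_left]
  refine (ContinuousMultilinearMap.norm_compContinuousLinearMap_le
    (iteratedFDeriv ℝ k f (p + g x)) fun _ => g).trans ?_
  simp

theorem jetNorm_comp_affine_le {U : Type*} [NormedAddCommGroup U] [NormedSpace ℝ U]
    {f : V → ℂ} (hf : ContDiff ℝ ∞ f) (g : U →L[ℝ] V) (hg : ‖g‖ ≤ 1) (p : V) (K : ℕ) (x : U) :
    jetNorm K (fun y => f (p + g y)) x ≤ jetNorm K f (p + g x) := by
  refine Finset.sum_le_sum fun k _ => (norm_iteratedFDeriv_comp_affine_le hf g p k x).trans ?_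
  exact mul_le_of_le_one_right (norm_nonneg _) (pow_le_one₀ (norm_nonneg _) hg)

theorem SmoothBdd.comp_affine {U : Type*} [NormedAddCommGroup U] [NormedSpace ℝ U]
    {f : V → ℂ} (hf : SmoothBdd f) (g : U →L[ℝ] V) (p : V) :
    SmoothBdd (fun y => f (p + g y)) := by
  refine ⟨hf.1.comp (contDiff_const.add g.contDiff), fun K => ?_⟩
  obtain ⟨M, hM0, hM⟩ := hf.exists_bound K
  refine ⟨∑ k ∈ Finset.range (K + 1), M * ‖g‖ ^ k, fun x => Finset.sum_le_sum fun k hk => ?_⟩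
  refine (norm_iteratedFDeriv_comp_affine_le hf.1 g p k x).trans ?_
  gcongr
  exact (norm_iteratedFDeriv_le_jetNorm (by have := Finset.mem_range.1 hk; lia) f _).trans (hM _)

theorem SmoothBdd.comp_clm {U : Type*} [NormedAddCommGroup U] [NormedSpace ℝ U]
    {f : V → ℂ} (hf : SmoothBdd f) (g : U →L[ℝ] V) : SmoothBdd (fun y => f (g y)) := by
  simpa using hf.comp_affine g 0

theorem SmoothBdd.of_hasCompactSupport {f : V → ℂ} (hf : ContDiff ℝ ∞ f)
    (hs : HasCompactSupport f) : SmoothBdd f := by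
  refine ⟨hf, fun K => ?_⟩
  have : ∀ k : ℕ, ∃ M, ∀ x, ‖iteratedFDeriv ℝ k f x‖ ≤ M := fun k =>
    (hs.iteratedFDeriv k).exists_bound_of_continuous
      (hf.continuous_iteratedFDeriv (mod_cast le_top))
  choose M hM using this
  exact ⟨∑ k ∈ Finset.range (K + 1), M k, fun x => Finset.sum_le_sum fun k _ => hM k x⟩

/-- A bounded solution of the Riccati type equation `u' = r + c u²` has bounded derivatives. -/
theorem SmoothBdd.of_riccati {u r : ℝ → ℂ} (hu : ContDiff ℝ ∞ u) (hr : SmoothBdd r) (c : ℂ)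
    {M : ℝ} (hM : ∀ t, ‖u t‖ ≤ M) (hd : ∀ t, deriv u t = r t + c * (u t * u t)) :
    SmoothBdd u := by
  refine ⟨hu, fun K => ?_⟩
  induction K with
  | zero => exact ⟨M, fun x => by simpa [jetNorm] using hM x⟩
  | succ K ih =>
    obtain ⟨A, hA⟩ := ih
    obtain ⟨B, hB⟩ := hr.2 K
    refine ⟨A + (B + ‖c‖ * (2 ^ (K + 1) * (A * A))), fun x => ?_⟩
    rw [jetNorm, Finset.sum_range_succ]
    refine add_le_add (hA x) ?_
    -- The equation trades one derivative of `u` for a polynomial in `u`, so order `K + 1` is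
    -- bounded by the jet of order `K`.
    have hd' : deriv u = fun t => r t + c * (u t * u t) := funext hd
    rw [norm_iteratedFDeriv_eq_norm_iteratedDeriv, iteratedDeriv_succ', hd',
      ← norm_iteratedFDeriv_eq_norm_iteratedDeriv]
    refine (norm_iteratedFDeriv_le_jetNorm le_rfl _ _).trans ?_
    refine (jetNorm_add_le hr.1 (contDiff_const.mul (hu.mul hu)) K x).trans ?_
    refine add_le_add (hB x) ?_
    rw [jetNorm_const_mul (hu.mul hu)]
    gcongr
    refine (jetNorm_mul_le hu hu K x).trans ?_
    have h0 := jetNorm_nonneg K u x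
    gcongr
    · exact h0.trans (hA x)
    · exact hA x
    · exact hA x

end Jet

/-! ### Integration by parts that produces integrable decay. -/

section Osc

open MeasureTheory Filter Topology

/-- Smooth functions all of whose derivatives are integrable. -/
def JetIntegrable {d : ℕ} (f : E d → ℂ) : Prop :=
  ContDiff ℝ ∞ f ∧ ∀ K : ℕ, Integrable (jetNorm K f)

/-- A phase whose derivatives along the vectors `v i` are the coordinates divided by `h`. -/
structure IsCoordPhase {d : ℕ} (v : Fin d → E d) (h : ℝ) (φ : E d → ℝ) : Prop where
  contDiff : ContDiff ℝ ∞ φ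
  fderiv_apply : ∀ (i : Fin d) (W : E d), fderiv ℝ φ W (v i) = W i / h

/-- The oscillating factor `e^{iφ}`. -/
noncomputable def phaseExp {d : ℕ} (φ : E d → ℝ) (W : E d) : ℂ := Complex.exp (Complex.I * (φ W : ℂ))

variable {d : ℕ}

theorem norm_phaseExp (φ : E d → ℝ) (W : E d) : ‖phaseExp φ W‖ = 1 := by
  rw [phaseExp, mul_comm, Complex.norm_exp_ofReal_mul_I]

namespace JetIntegrable

theorem integrable {f : E d → ℂ} (hf : JetIntegrable f) : Integrable f :=
  (hf.2 0).mono' hf.1.continuous.aestronglyMeasurable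
    (Eventually.of_forall fun x => norm_le_jetNorm 0 f x)

theorem of_jetNorm_le {f : E d → ℂ} (hf : ContDiff ℝ ∞ f)
    (h : ∀ K, ∃ g : E d → ℝ, Integrable g ∧ ∀ x, jetNorm K f x ≤ g x) : JetIntegrable f := by
  refine ⟨hf, fun K => ?_⟩
  obtain ⟨g, hg, hfg⟩ := h K
  refine hg.mono' (jetNorm_continuous hf K).aestronglyMeasurable (Eventually.of_forall fun x => ?_)
  rw [Real.norm_of_nonneg (jetNorm_nonneg _ _ _)]
  exact hfg x

theorem bdd_mul {f g : E d → ℂ} (hf : SmoothBdd f) (hg : JetIntegrable g) :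
    JetIntegrable (fun x => f x * g x) := by
  refine of_jetNorm_le (hf.1.mul hg.1) fun K => ?_
  obtain ⟨M, hM0, hM⟩ := hf.exists_bound K
  refine ⟨fun x => 2 ^ (K + 1) * (M * jetNorm K g x), ((hg.2 K).const_mul _).const_mul _,
    fun x => (jetNorm_mul_le hf.1 hg.1 K x).trans ?_⟩
  have := jetNorm_nonneg K g x
  exact mul_le_mul_of_nonneg_left (mul_le_mul_of_nonneg_right (hM x) this) (by positivity)

theorem dirDeriv {g : E d → ℂ} (hg : JetIntegrable g) (v : E d) : JetIntegrable (dirDeriv v g) :=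
  of_jetNorm_le (dirDeriv_contDiff hg.1 v) fun K =>
    ⟨fun x => ‖v‖ * jetNorm (K + 1) g x, (hg.2 _).const_mul _, jetNorm_dirDeriv_le hg.1 v K⟩

theorem add {f g : E d → ℂ} (hf : JetIntegrable f) (hg : JetIntegrable g) :
    JetIntegrable (fun x => f x + g x) :=
  of_jetNorm_le (hf.1.add hg.1) fun K =>
    ⟨fun x => jetNorm K f x + jetNorm K g x, (hf.2 K).add (hg.2 K), jetNorm_add_le hf.1 hg.1 K⟩

theorem sub {f g : E d → ℂ} (hf : JetIntegrable f) (hg : JetIntegrable g) :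
    JetIntegrable (fun x => f x - g x) :=
  of_jetNorm_le (hf.1.sub hg.1) fun K =>
    ⟨fun x => jetNorm K f x + jetNorm K g x, (hf.2 K).add (hg.2 K), jetNorm_sub_le hf.1 hg.1 K⟩

theorem const_mul {g : E d → ℂ} (hg : JetIntegrable g) (c : ℂ) :
    JetIntegrable (fun x => c * g x) := bdd_mul (SmoothBdd.const c) hg

end JetIntegrable

theorem integrable_phaseExp_mul {φ : E d → ℝ} (hφ : Continuous φ) {g : E d → ℂ}
    (hg : Integrable g) : Integrable (fun W => phaseExp φ W * g W) := by
  refine hg.bdd_mul (c := 1) ?_ (Eventually.of_forall fun W => (norm_phaseExp φ W).le)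
  refine Continuous.aestronglyMeasurable ?_
  unfold phaseExp
  fun_prop

theorem IsCoordPhase.fderiv_phaseExp {v : Fin d → E d} {h : ℝ} {φ : E d → ℝ}
    (hφ : IsCoordPhase v h φ) (i : Fin d) (W : E d) :
    fderiv ℝ (phaseExp φ) W (v i) = Complex.I * (W i / h : ℝ) * phaseExp φ W := by
  have h1 : HasFDerivAt φ (fderiv ℝ φ W) W :=
    (hφ.contDiff.differentiable (by simp)).differentiableAt.hasFDerivAt
  have h2 : HasFDerivAt (fun W => Complex.I * (φ W : ℂ)) _ W :=
    (Complex.ofRealCLM.hasFDerivAt.comp W h1).const_mul Complex.I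
  have h3 : HasFDerivAt (phaseExp φ) _ W := h2.cexp
  rw [h3.fderiv]
  simp [hφ.fderiv_apply, phaseExp]
  ring

/-- The derivative of `e^{iφ}` along `v i` is `(i W i / h) e^{iφ}`; moving that derivative onto `g`
gives the identity. Integrability of `W i * g` is a separate assumption because it does not follow
from that of `g`. -/
theorem IsCoordPhase.integral_coord_mul {v : Fin d → E d} {h : ℝ} {φ : E d → ℝ}
    (hφ : IsCoordPhase v h φ) (hh : h ≠ 0) (i : Fin d) {g : E d → ℂ} (hg : JetIntegrable g)
    (hWg : Integrable (fun W => (W i : ℂ) * g W)) :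
    ∫ W, phaseExp φ W * ((W i : ℂ) * g W)
      = ∫ W, phaseExp φ W * (Complex.I * h * dirDeriv (v i) g W) := by
  have hc := hφ.contDiff.continuous
  have hd : Differentiable ℝ (phaseExp φ) := by
    have := hφ.contDiff.differentiable (by simp)
    unfold phaseExp
    fun_prop
  have e1 : ∀ W, fderiv ℝ (phaseExp φ) W (v i) * g W
      = Complex.I / h * (phaseExp φ W * ((W i : ℂ) * g W)) := by
    intro W
    rw [hφ.fderiv_phaseExp]
    push_cast
    ring
  have key := integral_mul_fderiv_eq_neg_fderiv_mul_of_integrable (μ := (volume : Measure (E d)))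
    (𝕜 := ℂ) (f := phaseExp φ) (g := g) (v := v i) ?_ ?_ ?_ ?_ ?_
  · simp only [e1] at key
    have e2 : ∀ W, phaseExp φ W * (Complex.I * h * dirDeriv (v i) g W)
        = Complex.I * h * (phaseExp φ W * fderiv ℝ g W (v i)) := by
      intro W; rw [dirDeriv]; ring
    simp only [e2]
    rw [integral_const_mul, key, integral_const_mul]
    have : (h : ℂ) ≠ 0 := by exact_mod_cast hh
    field_simp
    simp
  · simp only [e1]
    exact (integrable_phaseExp_mul hc hWg).const_mul _
  · exact integrable_phaseExp_mul hc (hg.dirDeriv (v i)).integrable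
  · exact integrable_phaseExp_mul hc hg.integrable
  · exact fun x _ => hd x
  · exact fun x _ => (hg.1.differentiable (by simp)) x

/-- The decaying factor `1 / (W i + i)`. -/
noncomputable def cauchyFactor (i : Fin d) (W : E d) : ℂ := ((W i : ℂ) + Complex.I)⁻¹

theorem ofReal_add_I_ne_zero (t : ℝ) : (t : ℂ) + Complex.I ≠ 0 := by
  intro h
  simpa using congrArg Complex.im h

theorem norm_ofReal_add_I_inv_le (t : ℝ) : ‖((t : ℂ) + Complex.I)⁻¹‖ ≤ 1 := by
  rw [norm_inv]
  refine inv_le_one_of_one_le₀ ?_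
  simpa using Complex.abs_im_le_norm ((t : ℂ) + Complex.I)

theorem smoothBdd_ofReal_add_I_inv : SmoothBdd (fun t : ℝ => ((t : ℂ) + Complex.I)⁻¹) := by
  have h1 : ContDiff ℝ ∞ (fun t : ℝ => (t : ℂ) + Complex.I) :=
    Complex.ofRealCLM.contDiff.add contDiff_const
  -- The function `u = 1 / (t + i)` solves `u' = -u²`.
  refine SmoothBdd.of_riccati (h1.inv ofReal_add_I_ne_zero) (SmoothBdd.const 0) (-1)
    norm_ofReal_add_I_inv_le fun t => ?_
  have h2 : HasDerivAt (fun t : ℝ => (t : ℂ) + Complex.I) 1 t :=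
    (Complex.ofRealCLM.hasDerivAt (x := t)).add_const _
  rw [(h2.fun_inv (ofReal_add_I_ne_zero t)).deriv]
  field_simp
  simp

theorem smoothBdd_cauchyFactor (i : Fin d) : SmoothBdd (cauchyFactor i) :=
  smoothBdd_ofReal_add_I_inv.comp_clm (EuclideanSpace.proj i : E d →L[ℝ] ℝ)

theorem coord_add_I_mul_cauchyFactor (i : Fin d) (W : E d) :
    ((W i : ℂ) + Complex.I) * cauchyFactor i W = 1 :=
  mul_inv_cancel₀ (ofReal_add_I_ne_zero _)

theorem dirDeriv_cauchyFactor (i : Fin d) (v W : E d) :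
    dirDeriv v (cauchyFactor i) W = -((v i : ℂ) * cauchyFactor i W) * cauchyFactor i W := by
  have h1 : HasFDerivAt (fun W : E d => (W i : ℂ) + Complex.I)
      (Complex.ofRealCLM.comp (EuclideanSpace.proj i : E d →L[ℝ] ℝ)) W :=
    ((Complex.ofRealCLM.comp (EuclideanSpace.proj i : E d →L[ℝ] ℝ)).hasFDerivAt).add_const _
  have h2 : HasFDerivAt (cauchyFactor i) _ W :=
    (hasFDerivAt_inv' (𝕜 := ℝ) (ofReal_add_I_ne_zero (W i))).comp W h1
  rw [dirDeriv, h2.fderiv]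
  change -(((W i : ℂ) + Complex.I)⁻¹ * (v i : ℂ) * ((W i : ℂ) + Complex.I)⁻¹) = _
  rw [cauchyFactor]
  ring

/-- The product of the factors `1 / (W i + i)` over a list of indices. -/
noncomputable def weight (L : List (Fin d)) (W : E d) : ℂ := (L.map fun i => cauchyFactor i W).prod

/-- Minus the logarithmic derivative of `weight L` along `v`. -/
noncomputable def weightLogDeriv (v : E d) (L : List (Fin d)) (W : E d) : ℂ :=
  (L.map fun i => (v i : ℂ) * cauchyFactor i W).sum

/-- The differential operator that remains after integrating by parts once for every index in a
list, each integration producing a factor `1 / (W i + i)`. -/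
noncomputable def regOp (v : Fin d → E d) (h : ℝ) : List (Fin d) → (E d → ℂ) → E d → ℂ
  | [], g => g
  | i :: L, g => fun W => Complex.I * (regOp v h L g W + h * dirDeriv (v i) (regOp v h L g) W
      - h * (weightLogDeriv (v i) L W * regOp v h L g W))

theorem weight_smoothBdd (L : List (Fin d)) : SmoothBdd (weight L) := by
  induction L with
  | nil => exact SmoothBdd.const (V := E d) 1
  | cons i L ih =>
    have e : weight (i :: L) = fun W => cauchyFactor i W * weight L W := by ext; simp [weight]
    exact e ▸ (smoothBdd_cauchyFactor i).mul ih

theorem weightLogDeriv_smoothBdd (v : E d) (L : List (Fin d)) : SmoothBdd (weightLogDeriv v L) := by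
  induction L with
  | nil => exact SmoothBdd.const (V := E d) 0
  | cons i L ih =>
    have e : weightLogDeriv v (i :: L)
        = fun W => (v i : ℂ) * cauchyFactor i W + weightLogDeriv v L W := by
      ext; simp [weightLogDeriv]
    exact e ▸ ((smoothBdd_cauchyFactor i).const_mul (v i : ℂ)).add ih

/-- Differentiation reproduces the weight up to a bounded factor, so decay already gained is never
lost in later integrations by parts. -/
theorem dirDeriv_weight (v : E d) (L : List (Fin d)) (W : E d) :
    dirDeriv v (weight L) W = -(weightLogDeriv v L W * weight L W) := by
  induction L with
  | nil =>
    have : weight ([] : List (Fin d)) = fun _ => 1 := by ext; simp [weight]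
    simp [weightLogDeriv, this, dirDeriv]
  | cons i L ih =>
    have e : weight (i :: L) = fun W => cauchyFactor i W * weight L W := by ext; simp [weight]
    rw [e, dirDeriv_mul (smoothBdd_cauchyFactor i).1 (weight_smoothBdd L).1, ih,
      dirDeriv_cauchyFactor]
    simp only [weightLogDeriv, List.map_cons, List.sum_cons]
    ring

variable {v : Fin d → E d} {h : ℝ}

theorem regOp_contDiff (L : List (Fin d)) {g : E d → ℂ} (hg : ContDiff ℝ ∞ g) :
    ContDiff ℝ ∞ (regOp v h L g) := by
  induction L with
  | nil => exact hg
  | cons i L ih =>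
    exact contDiff_const.mul ((ih.add (contDiff_const.mul (dirDeriv_contDiff ih _))).sub
      (contDiff_const.mul ((weightLogDeriv_smoothBdd _ _).1.mul ih)))

theorem regOp_jetIntegrable (L : List (Fin d)) {g : E d → ℂ} (hg : JetIntegrable g) :
    JetIntegrable (regOp v h L g) := by
  induction L with
  | nil => exact hg
  | cons i L ih =>
    exact ((ih.add ((ih.dirDeriv _).const_mul _)).sub
      ((JetIntegrable.bdd_mul (weightLogDeriv_smoothBdd _ _) ih).const_mul _)).const_mul _

theorem regOp_sub (L : List (Fin d)) {f g : E d → ℂ} (hf : ContDiff ℝ ∞ f) (hg : ContDiff ℝ ∞ g) :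
    regOp v h L (fun W => f W - g W) = fun W => regOp v h L f W - regOp v h L g W := by
  induction L with
  | nil => rfl
  | cons i L ih =>
    funext W
    simp only [regOp]
    rw [ih, dirDeriv_sub (regOp_contDiff L hf) (regOp_contDiff L hg)]
    ring

/-- Only nonnegative powers of `h` occur in `regOp`, whence a constant uniform in `0 < h ≤ 1`; each
index in the list costs one derivative. -/
theorem exists_jetNorm_regOp_le (hv : ∀ i, ‖v i‖ ≤ 1) (L : List (Fin d)) (K : ℕ) :
    ∃ C : ℝ, 0 ≤ C ∧ ∀ h : ℝ, 0 < h → h ≤ 1 → ∀ g : E d → ℂ, ContDiff ℝ ∞ g → ∀ W,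
      jetNorm K (regOp v h L g) W ≤ C * jetNorm (K + L.length) g W := by
  induction L generalizing K with
  | nil => exact ⟨1, zero_le_one, fun h _ _ g _ W => by simp [regOp]⟩
  | cons i L ih =>
    obtain ⟨C, hC0, hC⟩ := ih (K + 1)
    obtain ⟨M, hM0, hM⟩ := (weightLogDeriv_smoothBdd (v i) L).exists_bound K
    refine ⟨C + C + 2 ^ (K + 1) * (M * C), by positivity, fun h h0 h1 g hg W => ?_⟩
    have hT : ContDiff ℝ ∞ (regOp v h L g) := regOp_contDiff L hg
    have hD := dirDeriv_contDiff hT (v i)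
    have hW := (weightLogDeriv_smoothBdd (v i) L).1
    have hb := hC h h0 h1 g hg W
    have hlen : K + 1 + L.length = K + (i :: L).length := by simp; ring
    rw [hlen] at hb
    set B := jetNorm (K + (i :: L).length) g W
    have hn : ‖(h : ℂ)‖ ≤ 1 := by simpa [abs_of_pos h0] using h1
    have b1 : jetNorm K (regOp v h L g) W ≤ C * B := (jetNorm_mono (by lia) _ _).trans hb
    have b2 : jetNorm K (fun W => (h : ℂ) * dirDeriv (v i) (regOp v h L g) W) W ≤ C * B := by
      rw [jetNorm_const_mul hD]
      refine (mul_le_of_le_one_left (jetNorm_nonneg _ _ _) hn).trans ?_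
      refine (jetNorm_dirDeriv_le hT _ _ _).trans ?_
      exact (mul_le_of_le_one_left (jetNorm_nonneg _ _ _) (hv i)).trans hb
    have b3 : jetNorm K (fun W => (h : ℂ) * (weightLogDeriv (v i) L W * regOp v h L g W)) W
        ≤ 2 ^ (K + 1) * (M * (C * B)) := by
      rw [jetNorm_const_mul (hW.mul hT)]
      refine (mul_le_of_le_one_left (jetNorm_nonneg _ _ _) hn).trans ?_
      refine (jetNorm_mul_le hW hT K W).trans ?_
      have := jetNorm_nonneg K (regOp v h L g) W
      gcongr
      exact hM W
    have hI : ‖Complex.I‖ = 1 := Complex.norm_I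
    simp only [regOp]
    rw [jetNorm_const_mul ((hT.add (contDiff_const.mul hD)).sub
      (contDiff_const.mul (hW.mul hT))), hI, one_mul]
    refine (jetNorm_sub_le (hT.add (contDiff_const.mul hD))
      (contDiff_const.mul (hW.mul hT)) K W).trans ?_
    have b4 := jetNorm_add_le hT (contDiff_const.mul hD : ContDiff ℝ ∞ fun W => (h : ℂ) * _) K W
    linarith

theorem IsCoordPhase.integral_eq_integral_regOp {φ : E d → ℝ} (hφ : IsCoordPhase v h φ)
    (hh : h ≠ 0) (hv : ∀ i, v i i = 0) (L : List (Fin d)) {g : E d → ℂ} (hg : JetIntegrable g) :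
    ∫ W, phaseExp φ W * g W = ∫ W, phaseExp φ W * (weight L W * regOp v h L g W) := by
  induction L with
  | nil => simp [weight, regOp]
  | cons i L ih =>
    rw [ih]
    set G := regOp v h L g
    have hG : JetIntegrable G := regOp_jetIntegrable L hg
    have hc := hφ.contDiff.continuous
    have hw : SmoothBdd (weight (i :: L)) := weight_smoothBdd _
    have hg1 : JetIntegrable (fun W => weight (i :: L) W * G W) := hG.bdd_mul hw
    -- Insert `1 = (W i + i) * cauchyFactor i W`; the `W i` part will be integrated by parts and the
    -- constant part kept.
    have e0 : ∀ W, weight L W * G W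
        = (W i : ℂ) * (weight (i :: L) W * G W) + Complex.I * (weight (i :: L) W * G W) := by
      intro W
      have : weight (i :: L) W = cauchyFactor i W * weight L W := by simp [weight]
      rw [this]
      linear_combination (-weight L W * G W) * coord_add_I_mul_cauchyFactor i W
    -- By `e0` this function is a difference of two integrable ones.
    have hWg : Integrable (fun W => (W i : ℂ) * (weight (i :: L) W * G W)) := by
      have := (hG.bdd_mul (weight_smoothBdd L)).integrable.sub (hg1.const_mul Complex.I).integrable
      refine this.congr (Eventually.of_forall fun W => ?_)
      simp only [Pi.sub_apply, e0 W]
      ring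
    have e1 : ∀ W, dirDeriv (v i) (fun W => weight (i :: L) W * G W) W
        = weight (i :: L) W * (dirDeriv (v i) G W - weightLogDeriv (v i) L W * G W) := by
      intro W
      rw [dirDeriv_mul hw.1 hG.1, dirDeriv_weight]
      -- Since `v i` has no `i`-th component, the newly inserted factor is not differentiated.
      have : weightLogDeriv (v i) (i :: L) W = weightLogDeriv (v i) L W := by
        simp [weightLogDeriv, hv i]
      rw [this]; ring
    simp only [e0, mul_add]
    rw [integral_add (integrable_phaseExp_mul hc hWg)
      (integrable_phaseExp_mul hc (hg1.const_mul _).integrable),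
      hφ.integral_coord_mul hh i hg1 hWg,
      ← integral_add (integrable_phaseExp_mul hc ((hg1.dirDeriv _).const_mul _).integrable)
      (integrable_phaseExp_mul hc (hg1.const_mul _).integrable)]
    refine integral_congr_ae (Eventually.of_forall fun W => ?_)
    simp only [e1, regOp]
    ring

/-- Every index, listed twice. -/
def twiceAll (d : ℕ) : List (Fin d) := List.finRange d ++ List.finRange d

theorem norm_weight_twiceAll (W : E d) : ‖weight (twiceAll d) W‖ = ∏ i, (1 + W i ^ 2)⁻¹ := by
  have e : weight (twiceAll d) W = ∏ i, (cauchyFactor i W * cauchyFactor i W) := by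
    rw [Finset.prod_mul_distrib]
    simp [weight, twiceAll, List.prod_ofFn, ← List.ofFn_eq_map]
  rw [e, norm_prod]
  refine Finset.prod_congr rfl fun i _ => ?_
  rw [cauchyFactor, ← mul_inv, norm_inv, norm_mul, Complex.norm_mul_self_eq_normSq]
  simp [Complex.normSq_apply, sq, add_comm]

/-- A single factor `1 / (W i + i)` per coordinate decays too slowly to be integrable; two of them
have modulus `1 / (1 + W i ^ 2)`. -/
theorem integrable_weight_twiceAll : Integrable (weight (twiceAll d)) := by
  have h1 : Integrable (fun x : Fin d → ℝ => ∏ i, (1 + x i ^ 2)⁻¹) :=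
    Integrable.fintype_prod (f := fun _ t => (1 + t ^ 2)⁻¹) fun _ => integrable_inv_one_add_sq
  have h2 : Integrable (fun W : E d => ∏ i, (1 + W i ^ 2)⁻¹) := by
    exact (PiLp.volume_preserving_ofLp (Fin d)).integrable_comp_of_integrable h1
  exact h2.mono' (weight_smoothBdd _).1.continuous.aestronglyMeasurable
    (Eventually.of_forall fun W => (norm_weight_twiceAll W).le)

end Osc

/-! ### Values of oscillatory integrals with bounded smooth amplitudes. -/

section OscValue

open MeasureTheory Filter Topology

variable {d : ℕ} {v : Fin d → E d} {h : ℝ} {φ : E d → ℝ}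

/-- The absolutely convergent representation of an oscillatory integral. -/
noncomputable def oscVal (v : Fin d → E d) (h : ℝ) (φ : E d → ℝ) (F : E d → ℂ) : ℂ :=
  ∫ W, phaseExp φ W * (weight (twiceAll d) W * regOp v h (twiceAll d) F W)

/-- The number of derivatives controlling an oscillatory integral on `ℝᵈ`. -/
def oscOrder (d : ℕ) : ℕ := (twiceAll d).length

theorem exists_norm_oscVal_le (hv : ∀ i, ‖v i‖ ≤ 1) :
    ∃ C : ℝ, 0 ≤ C ∧ ∀ (h : ℝ) (φ : E d → ℝ), 0 < h → h ≤ 1 → ∀ F : E d → ℂ, SmoothBdd F →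
      ∀ M : ℝ, (∀ W, jetNorm (oscOrder d) F W ≤ M) → ‖oscVal v h φ F‖ ≤ C * M := by
  obtain ⟨C, hC0, hC⟩ := exists_jetNorm_regOp_le hv (twiceAll d) 0
  refine ⟨C * ∫ W, ‖weight (twiceAll d) W‖,
    mul_nonneg hC0 (integral_nonneg fun _ => norm_nonneg _), fun h φ h0 h1 F hF M hM => ?_⟩
  have hw : Integrable (fun W => ‖weight (twiceAll d) W‖ * (C * M)) :=
    (integrable_weight_twiceAll (d := d)).norm.mul_const _
  refine (norm_integral_le_of_norm_le hw (Eventually.of_forall fun W => ?_)).trans ?_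
  · rw [norm_mul, norm_phaseExp, one_mul, norm_mul]
    gcongr
    refine (norm_le_jetNorm 0 _ W).trans ((hC h h0 h1 F hF.1 W).trans ?_)
    rw [zero_add]
    gcongr
    exact hM W
  · rw [integral_mul_const]
    exact le_of_eq (by ring)

/-- For each integrable amplitude `G ε` the plain integral equals its regularized form, where the
modulus of the weight times a constant is a majorant independent of `ε`. Pointwise convergence of
jets then suffices for dominated convergence. -/
theorem IsCoordPhase.tendsto_integral (hφ : IsCoordPhase v h φ) (h0 : 0 < h) (h1 : h ≤ 1)
    (hv0 : ∀ i, v i i = 0) (hv : ∀ i, ‖v i‖ ≤ 1) {G : ℝ → E d → ℂ} {F : E d → ℂ} {M : ℝ}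
    (hF : ContDiff ℝ ∞ F) (hG : ∀ ε : ℝ, 0 < ε → JetIntegrable (G ε))
    (hM : ∀ ε : ℝ, 0 < ε → ε ≤ 1 → ∀ W, jetNorm (oscOrder d) (G ε) W ≤ M)
    (hlim : ∀ W, Tendsto (fun ε => jetNorm (oscOrder d) (fun y => G ε y - F y) W)
      (𝓝[>] 0) (𝓝 0)) :
    Tendsto (fun ε => ∫ W, phaseExp φ W * G ε W) (𝓝[>] 0) (𝓝 (oscVal v h φ F)) := by
  obtain ⟨C, hC0, hC⟩ := exists_jetNorm_regOp_le hv (twiceAll d) 0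
  have hpos : ∀ᶠ ε : ℝ in 𝓝[>] 0, 0 < ε ∧ ε ≤ 1 := by
    filter_upwards [Ioc_mem_nhdsGT (zero_lt_one (α := ℝ))] with ε hε using hε
  have heq : (fun ε => ∫ W, phaseExp φ W * (weight (twiceAll d) W *
      regOp v h (twiceAll d) (G ε) W)) =ᶠ[𝓝[>] 0] fun ε => ∫ W, phaseExp φ W * G ε W := by
    filter_upwards [hpos] with ε hε
    exact (hφ.integral_eq_integral_regOp h0.ne' hv0 (twiceAll d) (hG ε hε.1)).symm
  refine Tendsto.congr' heq ?_
  have hexp : Continuous (phaseExp φ) := by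
    have := hφ.contDiff.continuous
    unfold phaseExp
    fun_prop
  have hw := (weight_smoothBdd (twiceAll d)).1.continuous
  refine tendsto_integral_filter_of_dominated_convergence
    (fun W => ‖weight (twiceAll d) W‖ * (C * M)) ?_ ?_ (integrable_weight_twiceAll.norm.mul_const _)
    (Eventually.of_forall fun W => ?_)
  · filter_upwards [hpos] with ε hε
    exact (hexp.mul (hw.mul (regOp_contDiff _ (hG ε hε.1).1).continuous)).aestronglyMeasurable
  · filter_upwards [hpos] with ε hε
    refine Eventually.of_forall fun W => ?_
    rw [norm_mul, norm_phaseExp, one_mul, norm_mul]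
    gcongr
    refine (norm_le_jetNorm 0 _ W).trans ((hC h h0 h1 _ (hG ε hε.1).1 W).trans ?_)
    rw [zero_add]
    gcongr
    exact hM ε hε.1 hε.2 W
  · refine Tendsto.const_mul _ (Tendsto.const_mul _ ?_)
    rw [tendsto_iff_norm_sub_tendsto_zero]
    have hz : Tendsto (fun ε => C * jetNorm (oscOrder d) (fun y => G ε y - F y) W) (𝓝[>] 0) (𝓝 0) := by
      simpa using (hlim W).const_mul C
    refine squeeze_zero' (Eventually.of_forall fun _ => norm_nonneg _) ?_ hz
    filter_upwards [hpos] with ε hε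
    have hs := regOp_sub (v := v) (h := h) (twiceAll d) (hG ε hε.1).1 hF
    have := (norm_le_jetNorm 0 _ W).trans (hC h h0 h1 _ ((hG ε hε.1).1.sub hF) W)
    rw [hs, zero_add] at this
    exact this

theorem exists_schwartz_eq_one (d : ℕ) : ∃ ψ : SchwartzMap (E d) ℂ, ψ 0 = 1 := by
  let g : ContDiffBump (0 : E d) := ⟨1, 2, one_pos, one_lt_two⟩
  have h1 : HasCompactSupport (fun x => ((g x : ℝ) : ℂ)) :=
    g.hasCompactSupport.comp_left (g := fun t : ℝ => (t : ℂ)) Complex.ofReal_zero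
  have h2 : ContDiff ℝ ∞ (fun x => ((g x : ℝ) : ℂ)) :=
    Complex.ofRealCLM.contDiff.comp g.contDiff
  refine ⟨h1.toSchwartzMap h2, ?_⟩
  simp [g.one_of_mem_closedBall (x := 0) (by simp [g.rIn_pos.le])]

theorem norm_iteratedFDeriv_comp_smul_le {f : E d → ℂ} (hf : ContDiff ℝ ∞ f) {ε : ℝ} (hε : 0 < ε)
    (k : ℕ) (W : E d) :
    ‖iteratedFDeriv ℝ k (fun y => f (ε • y)) W‖ ≤ ε ^ k * ‖iteratedFDeriv ℝ k f (ε • W)‖ := by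
  have hn : ‖ε • ContinuousLinearMap.id ℝ (E d)‖ ≤ ε := by
    rw [norm_smul, Real.norm_of_nonneg hε.le]
    exact mul_le_of_le_one_right hε.le ContinuousLinearMap.norm_id_le
  have := norm_iteratedFDeriv_comp_affine_le hf (ε • ContinuousLinearMap.id ℝ (E d)) 0 k W
  simp only [zero_add, smul_apply, ContinuousLinearMap.id_apply] at this
  refine this.trans ?_
  rw [mul_comm]
  gcongr

theorem jetNorm_comp_smul_le {f : E d → ℂ} (hf : ContDiff ℝ ∞ f) {ε : ℝ} (h0 : 0 < ε)
    (h1 : ε ≤ 1) (K : ℕ) (W : E d) :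
    jetNorm K (fun y => f (ε • y)) W ≤ jetNorm K f (ε • W) := by
  unfold jetNorm
  refine Finset.sum_le_sum fun k _ => (norm_iteratedFDeriv_comp_smul_le hf h0 k W).trans ?_
  exact mul_le_of_le_one_left (norm_nonneg _) (pow_le_one₀ h0.le h1)

theorem smoothBdd_schwartz (ψ : SchwartzMap (E d) ℂ) : SmoothBdd ψ := by
  refine ⟨ψ.smooth ⊤, fun K => ?_⟩
  have : ∀ k : ℕ, ∃ C, ∀ x, ‖iteratedFDeriv ℝ k ψ x‖ ≤ C := fun k => by
    obtain ⟨C, -, hC⟩ := ψ.decay 0 k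
    exact ⟨C, by simpa using hC⟩
  choose C hC using this
  exact ⟨∑ k ∈ Finset.range (K + 1), C k, fun x => Finset.sum_le_sum fun k _ => hC k x⟩

theorem jetIntegrable_schwartz_comp_smul (ψ : SchwartzMap (E d) ℂ) {ε : ℝ} (hε : 0 < ε) :
    JetIntegrable (fun W => ψ (ε • W)) := by
  have hs : ContDiff ℝ ∞ ψ := ψ.smooth ⊤
  refine JetIntegrable.of_jetNorm_le (hs.comp (contDiff_const_smul ε)) fun K => ?_
  refine ⟨fun W => ∑ k ∈ Finset.range (K + 1), ε ^ k * ‖iteratedFDeriv ℝ k ψ (ε • W)‖, ?_,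
    fun W => Finset.sum_le_sum fun k _ => norm_iteratedFDeriv_comp_smul_le hs hε k W⟩
  refine integrable_finsetSum _ fun k _ => Integrable.const_mul ?_ _
  have : Integrable (fun W => ‖iteratedFDeriv ℝ k ψ W‖) := by
    simpa using ψ.integrable_pow_mul_iteratedFDeriv volume 0 k
  exact this.comp_smul hε.ne'

/-- Derivatives of the regularized functions `ψ(εW) F(W)` are bounded uniformly in `ε`. -/
theorem exists_jetNorm_cutoff_le (ψ : SchwartzMap (E d) ℂ) {F : E d → ℂ}
    (hF : SmoothBdd F) (K : ℕ) :
    ∃ M : ℝ, ∀ ε : ℝ, 0 < ε → ε ≤ 1 → ∀ W, jetNorm K (fun y => ψ (ε • y) * F y) W ≤ M := by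
  obtain ⟨A, hA0, hA⟩ := (smoothBdd_schwartz ψ).exists_bound K
  obtain ⟨B, hB0, hB⟩ := hF.exists_bound K
  refine ⟨2 ^ (K + 1) * (A * B), fun ε h0 h1 W => ?_⟩
  refine (jetNorm_mul_le (jetIntegrable_schwartz_comp_smul ψ h0).1 hF.1 K W).trans ?_
  have hψ : jetNorm K (fun y => ψ (ε • y)) W ≤ A :=
    (jetNorm_comp_smul_le (ψ.smooth ⊤) h0 h1 K W).trans (hA _)
  have := jetNorm_nonneg K F W
  gcongr
  exact hB W

/-- Derivatives of positive order of `ψ(ε ·)` carry a factor `ε`, while the term of order zero is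
`ψ(εW) - 1`, which tends to `ψ 0 - 1 = 0`. -/
theorem tendsto_jetNorm_cutoff_sub (ψ : SchwartzMap (E d) ℂ) (hψ : ψ 0 = 1)
    {F : E d → ℂ} (hF : SmoothBdd F) (K : ℕ) (W : E d) :
    Tendsto (fun ε : ℝ => jetNorm K (fun y => ψ (ε • y) * F y - F y) W) (𝓝[>] 0) (𝓝 0) := by
  obtain ⟨A, hA0, hA⟩ := (smoothBdd_schwartz ψ).exists_bound K
  have hpos : ∀ᶠ ε : ℝ in 𝓝[>] 0, 0 < ε ∧ ε ≤ 1 := by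
    filter_upwards [Ioc_mem_nhdsGT (zero_lt_one (α := ℝ))] with ε hε using hε
  have hlim : Tendsto (fun ε : ℝ => 2 ^ (K + 1) *
      ((K * (ε * A) + ‖ψ (ε • W) - 1‖) * jetNorm K F W)) (𝓝[>] 0) (𝓝 0) := by
    have hc : Continuous (fun ε : ℝ => 2 ^ (K + 1) *
        ((K * (ε * A) + ‖ψ (ε • W) - 1‖) * jetNorm K F W)) := by
      have := ψ.continuous
      fun_prop
    have := (hc.tendsto 0).mono_left (nhdsWithin_le_nhds (s := Set.Ioi 0))
    simpa [hψ] using this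
  refine squeeze_zero' (Eventually.of_forall fun _ => jetNorm_nonneg _ _ _) ?_ hlim
  filter_upwards [hpos] with ε ⟨h0, h1⟩
  have hs : ContDiff ℝ ∞ (fun y : E d => ψ (ε • y)) := (jetIntegrable_schwartz_comp_smul ψ h0).1
  have e : (fun y => ψ (ε • y) * F y - F y) = fun y => (ψ (ε • y) - 1) * F y := by
    ext y; ring
  rw [e]
  refine (jetNorm_mul_le (hs.sub contDiff_const) hF.1 K W).trans ?_
  refine mul_le_mul_of_nonneg_left (mul_le_mul_of_nonneg_right ?_ (jetNorm_nonneg _ _ _))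
    (by positivity)
  rw [jetNorm, Finset.sum_range_succ']
  refine add_le_add ?_ (by simp)
  have hk : ∀ k ∈ Finset.range K,
      ‖iteratedFDeriv ℝ (k + 1) (fun y => ψ (ε • y) - 1) W‖ ≤ ε * A := by
    intro k hk
    have : iteratedFDeriv ℝ (k + 1) (fun y => ψ (ε • y) - 1) W
        = iteratedFDeriv ℝ (k + 1) (fun y => ψ (ε • y)) W
          - iteratedFDeriv ℝ (k + 1) (fun _ : E d => (1 : ℂ)) W :=
      iteratedFDeriv_sub_apply (hs.contDiffAt.of_le (mod_cast le_top)) contDiffAt_const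
    rw [this, iteratedFDeriv_const_of_ne (by lia)]
    simp only [Pi.zero_apply, sub_zero]
    refine (norm_iteratedFDeriv_comp_smul_le (ψ.smooth ⊤) h0 _ W).trans ?_
    refine mul_le_mul ?_ ?_ (norm_nonneg _) h0.le
    · exact pow_le_of_le_one h0.le h1 (by lia)
    · exact (norm_iteratedFDeriv_le_jetNorm
        (by have := Finset.mem_range.1 hk; lia) _ _).trans (hA _)
  refine (Finset.sum_le_card_nsmul _ _ _ hk).trans ?_
  simp

theorem IsCoordPhase.hasOscillatoryIntegral (hφ : IsCoordPhase v h φ) (h0 : 0 < h) (h1 : h ≤ 1)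
    (hv0 : ∀ i, v i i = 0) (hv : ∀ i, ‖v i‖ ≤ 1) {F : E d → ℂ} (hF : SmoothBdd F) :
    HasOscillatoryIntegral φ F (oscVal v h φ F) := by
  intro ψ hψ
  have hG : ∀ ε : ℝ, 0 < ε → JetIntegrable (fun y => ψ (ε • y) * F y) := fun ε hε => by
    simpa only [mul_comm] using JetIntegrable.bdd_mul hF (jetIntegrable_schwartz_comp_smul ψ hε)
  refine ⟨fun ε hε => ?_, ?_⟩
  · simpa only [mul_assoc, phaseExp] using
      integrable_phaseExp_mul hφ.contDiff.continuous (hG ε hε).integrable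
  · obtain ⟨M, hM⟩ := exists_jetNorm_cutoff_le ψ hF (oscOrder d)
    simpa only [mul_assoc, phaseExp] using hφ.tendsto_integral h0 h1 hv0 hv hF.1 hG hM
      (tendsto_jetNorm_cutoff_sub ψ hψ hF _)

/-- One integration by parts in an oscillatory integral. -/
theorem IsCoordPhase.oscVal_eq_dirDeriv (hφ : IsCoordPhase v h φ) (h0 : 0 < h) (h1 : h ≤ 1)
    (hv0 : ∀ i, v i i = 0) (hv : ∀ i, ‖v i‖ ≤ 1) (i : Fin d) {F q : E d → ℂ} (hF : SmoothBdd F)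
    (hq : SmoothBdd q) (hqF : ∀ W, (W i : ℂ) * (q W * F W) = F W) :
    oscVal v h φ F
      = oscVal v h φ (fun W => Complex.I * h * dirDeriv (v i) (fun y => q y * F y) W) := by
  obtain ⟨ψ, hψ⟩ := exists_schwartz_eq_one d
  set H : E d → ℂ := fun y => q y * F y
  have hH : SmoothBdd H := hq.mul hF
  have hG : ∀ {F : E d → ℂ}, SmoothBdd F → ∀ ε : ℝ, 0 < ε → JetIntegrable (fun y => ψ (ε • y) * F y) :=
    fun hF ε hε => by
      simpa only [mul_comm] using JetIntegrable.bdd_mul hF (jetIntegrable_schwartz_comp_smul ψ hε)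
  obtain ⟨M, hM⟩ := exists_jetNorm_cutoff_le ψ hF (oscOrder d)
  -- One order more than for `F`, since the integrated-by-parts amplitude contains a derivative of
  -- `H`.
  obtain ⟨N, hN⟩ := exists_jetNorm_cutoff_le ψ hH (oscOrder d + 1)
  have hn : ‖Complex.I * (h : ℂ)‖ ≤ 1 := by simpa [abs_of_pos h0] using h1
  have lim1 := hφ.tendsto_integral h0 h1 hv0 hv hF.1 (hG hF) hM
    (tendsto_jetNorm_cutoff_sub ψ hψ hF _)
  have hle : ∀ {g : E d → ℂ}, ContDiff ℝ ∞ g → ∀ W,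
      jetNorm (oscOrder d) (fun W => Complex.I * h * dirDeriv (v i) g W) W
        ≤ jetNorm (oscOrder d + 1) g W := by
    intro g hg W
    rw [jetNorm_const_mul (dirDeriv_contDiff hg _)]
    refine (mul_le_of_le_one_left (jetNorm_nonneg _ _ _) hn).trans ?_
    refine (jetNorm_dirDeriv_le hg _ _ _).trans ?_
    exact mul_le_of_le_one_left (jetNorm_nonneg _ _ _) (hv i)
  have lim2 := hφ.tendsto_integral h0 h1 hv0 hv
    (G := fun ε W => Complex.I * h * dirDeriv (v i) (fun y => ψ (ε • y) * H y) W)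
    (F := fun W => Complex.I * h * dirDeriv (v i) H W) (M := N)
    ((hH.dirDeriv _).const_mul _).1
    (fun ε hε => ((hG hH ε hε).dirDeriv _).const_mul _)
    (fun ε hε hε1 W => (hle (hG hH ε hε).1 W).trans (hN ε hε hε1 W)) (fun W => ?_)
  -- For each `ε > 0` the two regularized integrals agree by an ordinary integration by parts, so
  -- their limits do.
  · refine tendsto_nhds_unique (lim1.congr' ?_) lim2
    filter_upwards [self_mem_nhdsWithin] with ε hε
    have e : ∀ W, ψ (ε • W) * F W = (W i : ℂ) * (ψ (ε • W) * H W) := by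
      intro W
      linear_combination (-ψ (ε • W)) * hqF W
    rw [← hφ.integral_coord_mul h0.ne' i (hG hH ε hε)]
    · simp only [e]
    · simpa only [e] using (hG hF ε hε).integrable
  · refine squeeze_zero' (Eventually.of_forall fun _ => jetNorm_nonneg _ _ _) ?_
      (tendsto_jetNorm_cutoff_sub ψ hψ hH (oscOrder d + 1) W)
    filter_upwards [self_mem_nhdsWithin] with ε hε
    have hs := (hG hH ε hε).1
    have := hle (hs.sub hH.1) W
    simp only [dirDeriv_sub hs hH.1] at this
    simpa only [mul_sub] using this

theorem HasOscillatoryIntegral.add {f g : E d → ℂ} {I J : ℂ} (hf : HasOscillatoryIntegral φ f I)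
    (hg : HasOscillatoryIntegral φ g J) :
    HasOscillatoryIntegral φ (fun W => f W + g W) (I + J) := by
  intro ψ hψ
  obtain ⟨f1, f2⟩ := hf ψ hψ
  obtain ⟨g1, g2⟩ := hg ψ hψ
  refine ⟨fun ε hε => by simp only [mul_add]; exact (f1 ε hε).add (g1 ε hε), ?_⟩
  refine (f2.add g2).congr' ?_
  filter_upwards [self_mem_nhdsWithin] with ε hε
  rw [← integral_add (f1 ε hε) (g1 ε hε)]
  simp only [mul_add]

theorem HasOscillatoryIntegral.const_mul {f : E d → ℂ} {I : ℂ} (hf : HasOscillatoryIntegral φ f I)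
    (c : ℂ) : HasOscillatoryIntegral φ (fun W => c * f W) (c * I) := by
  intro ψ hψ
  obtain ⟨f1, f2⟩ := hf ψ hψ
  simp only [mul_left_comm _ c]
  refine ⟨fun ε hε => (f1 ε hε).const_mul c, ?_⟩
  simp only [integral_const_mul]
  exact f2.const_mul c

theorem HasOscillatoryIntegral.oscillatoryIntegral_eq {f : E d → ℂ} {I : ℂ}
    (hf : HasOscillatoryIntegral φ f I) : oscillatoryIntegral φ f = I := by
  have hex : ∃ I, HasOscillatoryIntegral φ f I := ⟨I, hf⟩
  rw [oscillatoryIntegral, dif_pos hex]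
  exact hex.choose_spec.unique hf

end OscValue

/-! ### Iterated directional derivatives and a Taylor estimate. -/

section DirList

variable {V : Type*} [NormedAddCommGroup V] [NormedSpace ℝ V]

/-- Iterated directional derivatives along a list of vectors. -/
noncomputable def dirList : List V → (V → ℂ) → V → ℂ
  | [], F => F
  | w :: L, F => dirDeriv w (dirList L F)

theorem dirList_append (L L' : List V) (F : V → ℂ) :
    dirList (L ++ L') F = dirList L (dirList L' F) := by
  induction L with
  | nil => rfl
  | cons w L ih => simp only [List.cons_append, dirList, ih]

theorem dirList_contDiff {F : V → ℂ} (hF : ContDiff ℝ ∞ F) (L : List V) :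
    ContDiff ℝ ∞ (dirList L F) := by
  induction L with
  | nil => exact hF
  | cons w L ih => exact dirDeriv_contDiff ih w

theorem SmoothBdd.dirList {F : V → ℂ} (hF : SmoothBdd F) (L : List V) :
    SmoothBdd (dirList L F) := by
  induction L with
  | nil => exact hF
  | cons w L ih => exact ih.dirDeriv w

theorem norm_iteratedFDeriv_dirList_le {F : V → ℂ} (hF : ContDiff ℝ ∞ F) {L : List V}
    (hL : ∀ w ∈ L, ‖w‖ ≤ 1) (k : ℕ) (x : V) :
    ‖iteratedFDeriv ℝ k (dirList L F) x‖ ≤ ‖iteratedFDeriv ℝ (k + L.length) F x‖ := by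
  induction L generalizing k with
  | nil => rfl
  | cons w L ih =>
    refine (norm_iteratedFDeriv_dirDeriv_le (dirList_contDiff hF L) w k x).trans ?_
    refine (mul_le_of_le_one_left (norm_nonneg _) (hL w (by simp))).trans ?_
    refine (ih (fun u hu => hL u (by simp [hu])) (k + 1)).trans (le_of_eq ?_)
    rw [List.length_cons, Nat.add_right_comm, Nat.add_assoc]

theorem dirDeriv_comm {F : V → ℂ} (hF : ContDiff ℝ ∞ F) (v w : V) :
    dirDeriv v (dirDeriv w F) = dirDeriv w (dirDeriv v F) := by
  have hd : Differentiable ℝ (fderiv ℝ F) :=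
    (hF.fderiv_right (m := ∞) (by simp)).differentiable (by simp)
  have e : ∀ v w x, dirDeriv v (dirDeriv w F) x = fderiv ℝ (fderiv ℝ F) x v w := by
    intro v w x
    have : HasFDerivAt (dirDeriv w F) _ x :=
      (hd x).hasFDerivAt.clm_apply (hasFDerivAt_const w x)
    rw [dirDeriv, this.fderiv]
    simp
  ext x
  rw [e, e]
  exact (hF.contDiffAt (x := x)).isSymmSndFDerivAt
    (by rw [minSmoothness_of_isRCLikeNormedField]; exact WithTop.coe_le_coe.2 (le_top : (2 : ℕ∞) ≤ ⊤)) v w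

theorem dirList_perm {F : V → ℂ} (hF : ContDiff ℝ ∞ F) {L L' : List V} (h : L.Perm L') :
    dirList L F = dirList L' F := by
  induction h with
  | nil => rfl
  | cons w _ ih => simp only [dirList, ih]
  | swap v w L => exact dirDeriv_comm (dirList_contDiff hF L) _ _
  | trans _ _ ih1 ih2 => exact ih1.trans ih2

theorem iteratedFDeriv_apply_eq_dirList {F : V → ℂ} (hF : ContDiff ℝ ∞ F) (k : ℕ) (w : Fin k → V)
    (x : V) : iteratedFDeriv ℝ k F x w = dirList (List.ofFn w) F x := by
  induction k generalizing x with
  | zero => simp [dirList]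
  | succ k ih =>
    rw [iteratedFDeriv_succ_apply_left, List.ofFn_succ, dirList, dirDeriv]
    have e : dirList (List.ofFn fun i : Fin k => w i.succ) F
        = fun y => iteratedFDeriv ℝ k F y (Fin.tail w) := by
      ext y; rw [ih]; rfl
    have hd : Differentiable ℝ (iteratedFDeriv ℝ k F) :=
      hF.differentiable_iteratedFDeriv (mod_cast WithTop.coe_lt_top _)
    rw [e]
    rw [fderiv_continuousMultilinear_apply_const_apply (hd x)]

/-- On the left `v` is the innermost direction, on the right the outermost; symmetry of derivatives
allows it to be moved across the other `k`. -/
theorem iteratedFDeriv_dirDeriv {F : V → ℂ} (hF : ContDiff ℝ ∞ F) (k : ℕ) (v x : V) :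
    iteratedFDeriv ℝ k (dirDeriv v F) x = fderiv ℝ (iteratedFDeriv ℝ k F) x v := by
  ext w
  have h1 := iteratedFDeriv_apply_eq_dirList (dirDeriv_contDiff hF v) k w x
  have h2 := iteratedFDeriv_apply_eq_dirList hF (k + 1) (Fin.cons v w) x
  rw [iteratedFDeriv_succ_apply_left] at h2
  simp only [Fin.cons_zero, Fin.tail_cons] at h2
  rw [h1, h2, List.ofFn_succ]
  have e : dirList (List.ofFn w) (dirDeriv v F) = dirList (List.ofFn w ++ [v]) F := by
    rw [dirList_append]; rfl
  simp only [Fin.cons_zero, Fin.cons_succ]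
  rw [e, dirList_perm hF (List.perm_append_comm (l₁ := List.ofFn w) (l₂ := [v]))]
  rfl

/-- First order Taylor expansion, uniformly in the point and with all derivatives. -/
theorem exists_jetNorm_taylor_le {F : V → ℂ} (hF : SmoothBdd F) (K : ℕ) :
    ∃ C : ℝ, 0 ≤ C ∧ ∀ ξ x : V,
      jetNorm K (fun y => F (ξ + y) - F y - dirDeriv ξ F y) x ≤ C * ‖ξ‖ ^ 2 := by
  obtain ⟨M, hM0, hM⟩ := hF.exists_bound (K + 2)
  refine ⟨(K + 1) * M, by positivity, fun ξ x => ?_⟩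
  rw [mul_assoc]
  refine jetNorm_le_of_forall fun k hk => ?_
  have hs : ContDiff ℝ ∞ (fun y => F (ξ + y)) := hF.1.comp (contDiff_const.add contDiff_id)
  have e : iteratedFDeriv ℝ k (fun y => F (ξ + y) - F y - dirDeriv ξ F y) x
      = iteratedFDeriv ℝ k F (ξ + x) - iteratedFDeriv ℝ k F x
        - fderiv ℝ (iteratedFDeriv ℝ k F) x ξ := by
    have h1 : iteratedFDeriv ℝ k (fun y => F (ξ + y) - F y - dirDeriv ξ F y) x
        = iteratedFDeriv ℝ k (fun y => F (ξ + y) - F y) x - iteratedFDeriv ℝ k (dirDeriv ξ F) x :=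
      iteratedFDeriv_sub_apply ((hs.sub hF.1).contDiffAt.of_le (mod_cast le_top))
        ((dirDeriv_contDiff hF.1 ξ).contDiffAt.of_le (mod_cast le_top))
    have h2 : iteratedFDeriv ℝ k (fun y => F (ξ + y) - F y) x
        = iteratedFDeriv ℝ k (fun y => F (ξ + y)) x - iteratedFDeriv ℝ k F x :=
      iteratedFDeriv_sub_apply (hs.contDiffAt.of_le (mod_cast le_top))
        (hF.1.contDiffAt.of_le (mod_cast le_top))
    rw [h1, h2, iteratedFDeriv_comp_add_left, iteratedFDeriv_dirDeriv hF.1]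
  rw [e]
  have hd : ∀ j : ℕ, Differentiable ℝ (iteratedFDeriv ℝ j F) := fun j =>
    hF.1.differentiable_iteratedFDeriv (mod_cast WithTop.coe_lt_top _)
  -- Up to the currying isometry this is the increment of the derivative of order `k + 1`, which is
  -- Lipschitz because order `k + 2` is bounded by `M`.
  have hlip : ∀ y, ‖fderiv ℝ (iteratedFDeriv ℝ k F) y - fderiv ℝ (iteratedFDeriv ℝ k F) x‖
      ≤ M * ‖y - x‖ := by
    intro y
    have hcurry : fderiv ℝ (iteratedFDeriv ℝ k F) y - fderiv ℝ (iteratedFDeriv ℝ k F) x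
        = continuousMultilinearCurryLeftEquiv ℝ (fun _ : Fin (k + 1) => V) ℂ
          (iteratedFDeriv ℝ (k + 1) F y - iteratedFDeriv ℝ (k + 1) F x) := rfl
    rw [hcurry, LinearIsometryEquiv.norm_map]
    refine convex_univ.norm_image_sub_le_of_norm_fderiv_le (𝕜 := ℝ) (fun z _ => hd (k + 1) z)
      (fun z _ => ?_) (Set.mem_univ x) (Set.mem_univ y)
    rw [norm_fderiv_iteratedFDeriv]
    exact (norm_iteratedFDeriv_le_jetNorm (by lia) F z).trans (hM z)
  -- Mean value inequality after subtracting the linear part: on the segment the derivative varies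
  -- by at most `M * ‖ξ‖`, which gives the square.
  have key := (convex_segment x (ξ + x)).norm_image_sub_le_of_norm_fderiv_le'
    (f := iteratedFDeriv ℝ k F) (φ := fderiv ℝ (iteratedFDeriv ℝ k F) x) (C := M * ‖ξ‖)
    (fun z _ => hd k z) (fun z hz => ?_) (left_mem_segment ℝ _ _) (right_mem_segment ℝ _ _)
  · rw [add_sub_cancel_right] at key
    exact key.trans (le_of_eq (by ring))
  · refine (hlip z).trans ?_
    gcongr
    have := norm_sub_le_of_mem_segment hz
    simpa using this

end DirList

/-! ### Oscillatory integrals depending on a parameter. -/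

section Parameters

open MeasureTheory Filter Topology

variable {P : Type*} [NormedAddCommGroup P] [NormedSpace ℝ P]
variable {d : ℕ} {v : Fin d → E d} {h : ℝ} {φ : E d → ℝ}

theorem slice_eq (F : P × E d → ℂ) (X : P) :
    (fun W => F (X, W)) = fun W => F ((X, 0) + ContinuousLinearMap.inr ℝ P (E d) W) := by
  ext W; simp

theorem jetNorm_slice_le {F : P × E d → ℂ} (hF : ContDiff ℝ ∞ F) (K : ℕ) (X : P) (W : E d) :
    jetNorm K (fun W => F (X, W)) W ≤ jetNorm K F (X, W) := by
  have hn : ‖ContinuousLinearMap.inr ℝ P (E d)‖ ≤ 1 :=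
    ContinuousLinearMap.opNorm_le_bound _ zero_le_one fun W => by simp
  rw [slice_eq]
  simpa using jetNorm_comp_affine_le hF _ hn (X, 0) K W

theorem SmoothBdd.slice {F : P × E d → ℂ} (hF : SmoothBdd F) (X : P) :
    SmoothBdd (fun W => F (X, W)) := by
  rw [slice_eq]
  exact hF.comp_affine _ _

/-- An oscillatory integral depending on a parameter. -/
noncomputable def oscParam (v : Fin d → E d) (h : ℝ) (φ : E d → ℝ) (F : P × E d → ℂ) (X : P) : ℂ :=
  oscVal v h φ fun W => F (X, W)

/-- Additivity is inherited from the regularized integrals through uniqueness of the limit, with no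
computation on `regOp`. -/
theorem IsCoordPhase.oscVal_add (hφ : IsCoordPhase v h φ) (h0 : 0 < h) (h1 : h ≤ 1)
    (hv0 : ∀ i, v i i = 0) (hv : ∀ i, ‖v i‖ ≤ 1) {F G : E d → ℂ} (hF : SmoothBdd F)
    (hG : SmoothBdd G) :
    oscVal v h φ (fun W => F W + G W) = oscVal v h φ F + oscVal v h φ G :=
  (hφ.hasOscillatoryIntegral h0 h1 hv0 hv (hF.add hG)).unique
    ((hφ.hasOscillatoryIntegral h0 h1 hv0 hv hF).add (hφ.hasOscillatoryIntegral h0 h1 hv0 hv hG))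

theorem IsCoordPhase.oscVal_const_mul (hφ : IsCoordPhase v h φ) (h0 : 0 < h) (h1 : h ≤ 1)
    (hv0 : ∀ i, v i i = 0) (hv : ∀ i, ‖v i‖ ≤ 1) {F : E d → ℂ} (hF : SmoothBdd F) (c : ℂ) :
    oscVal v h φ (fun W => c * F W) = c * oscVal v h φ F :=
  (hφ.hasOscillatoryIntegral h0 h1 hv0 hv (hF.const_mul c)).unique
    ((hφ.hasOscillatoryIntegral h0 h1 hv0 hv hF).const_mul c)

theorem IsCoordPhase.oscVal_sub (hφ : IsCoordPhase v h φ) (h0 : 0 < h) (h1 : h ≤ 1)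
    (hv0 : ∀ i, v i i = 0) (hv : ∀ i, ‖v i‖ ≤ 1) {F G : E d → ℂ} (hF : SmoothBdd F)
    (hG : SmoothBdd G) :
    oscVal v h φ (fun W => F W - G W) = oscVal v h φ F - oscVal v h φ G := by
  have := hφ.oscVal_add h0 h1 hv0 hv hF (hG.const_mul (-1))
  rw [hφ.oscVal_const_mul h0 h1 hv0 hv hG] at this
  simpa [sub_eq_add_neg] using this

theorem IsCoordPhase.oscVal_sum (hφ : IsCoordPhase v h φ) (h0 : 0 < h) (h1 : h ≤ 1)
    (hv0 : ∀ i, v i i = 0) (hv : ∀ i, ‖v i‖ ≤ 1) {ι : Type*} (s : Finset ι) {F : ι → E d → ℂ}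
    (hF : ∀ j, SmoothBdd (F j)) :
    SmoothBdd (fun W => ∑ j ∈ s, F j W) ∧
      oscVal v h φ (fun W => ∑ j ∈ s, F j W) = ∑ j ∈ s, oscVal v h φ (F j) := by
  classical
  induction s using Finset.induction_on with
  | empty =>
    refine ⟨by simpa using SmoothBdd.const (V := E d) 0, ?_⟩
    simpa using hφ.oscVal_const_mul h0 h1 hv0 hv (SmoothBdd.const (V := E d) 0) 0
  | insert j s hj ih =>
    simp only [Finset.sum_insert hj]
    exact ⟨(hF j).add ih.1, by rw [hφ.oscVal_add h0 h1 hv0 hv (hF j) ih.1, ih.2]⟩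

theorem dirDeriv_add_left (F : P → ℂ) (ξ η x : P) :
    dirDeriv (ξ + η) F x = dirDeriv ξ F x + dirDeriv η F x := by
  simp [dirDeriv]

theorem dirDeriv_smul_left (F : P → ℂ) (c : ℝ) (ξ x : P) :
    dirDeriv (c • ξ) F x = c * dirDeriv ξ F x := by
  simp [dirDeriv]

/-- By linearity the left side is the oscillatory integral of the Taylor remainder of `F`, whose
jets are `O(‖ξ‖²)` uniformly in `W`. -/
theorem IsCoordPhase.exists_norm_oscParam_taylor_le
    (hφ : IsCoordPhase v h φ) (h0 : 0 < h) (h1 : h ≤ 1)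
    (hv0 : ∀ i, v i i = 0) (hv : ∀ i, ‖v i‖ ≤ 1) {F : P × E d → ℂ} (hF : SmoothBdd F) (X : P) :
    ∃ C : ℝ, ∀ ξ, ‖oscParam v h φ F (X + ξ) - oscParam v h φ F X
      - oscParam v h φ (dirDeriv (ξ, 0) F) X‖ ≤ C * ‖ξ‖ ^ 2 := by
  obtain ⟨C, hC0, hC⟩ := exists_norm_oscVal_le hv
  obtain ⟨D, hD0, hD⟩ := exists_jetNorm_taylor_le hF (oscOrder d)
  refine ⟨C * D, fun ξ => ?_⟩
  have hs : SmoothBdd (fun y : P × E d => F ((ξ, 0) + y)) :=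
    hF.comp_affine (ContinuousLinearMap.id ℝ (P × E d)) (ξ, 0)
  have hd : SmoothBdd (dirDeriv ((ξ, 0) : P × E d) F) := hF.dirDeriv _
  have e0 : (fun W => F (X + ξ, W)) = fun W => F ((ξ, 0) + (X, W)) := by
    funext W
    rw [Prod.mk_add_mk, zero_add, add_comm]
  rw [oscParam, oscParam, oscParam, e0,
    ← hφ.oscVal_sub h0 h1 hv0 hv (hs.slice X) (hF.slice X),
    ← hφ.oscVal_sub h0 h1 hv0 hv ((hs.slice X).sub (hF.slice X)) (hd.slice X)]
  set T : P × E d → ℂ := fun y => F ((ξ, 0) + y) - F y - dirDeriv (ξ, 0) F y with hTdef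
  have hT : SmoothBdd T := (hs.sub hF).sub hd
  have key := hC h φ h0 h1 (fun W => T (X, W)) (hT.slice X) (D * ‖ξ‖ ^ 2) fun W => by
    refine (jetNorm_slice_le hT.1 _ X W).trans ((hD (ξ, 0) (X, W)).trans (le_of_eq ?_))
    rw [Prod.norm_mk, norm_zero, max_eq_left (norm_nonneg ξ)]
  rw [← mul_assoc] at key
  exact key

/-- Differentiation under the oscillatory integral sign. -/
theorem IsCoordPhase.hasFDerivAt_oscParam [FiniteDimensional ℝ P]
    (hφ : IsCoordPhase v h φ) (h0 : 0 < h) (h1 : h ≤ 1)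
    (hv0 : ∀ i, v i i = 0) (hv : ∀ i, ‖v i‖ ≤ 1) {F : P × E d → ℂ} (hF : SmoothBdd F) (X : P) :
    ∃ L : P →L[ℝ] ℂ, HasFDerivAt (oscParam v h φ F) L X ∧
      ∀ ξ, L ξ = oscParam v h φ (dirDeriv (ξ, 0) F) X := by
  let L₀ : P →ₗ[ℝ] ℂ :=
    { toFun := fun ξ => oscParam v h φ (dirDeriv (ξ, 0) F) X
      map_add' := fun ξ η => by
        have e : ((ξ + η, 0) : P × E d) = (ξ, 0) + (η, 0) := by simp
        simp only [oscParam, e, dirDeriv_add_left]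
        exact hφ.oscVal_add h0 h1 hv0 hv ((hF.dirDeriv _).slice X) ((hF.dirDeriv _).slice X)
      map_smul' := fun c ξ => by
        have e : ((c • ξ, 0) : P × E d) = c • (ξ, 0) := by simp
        simp only [oscParam, e, dirDeriv_smul_left]
        rw [hφ.oscVal_const_mul h0 h1 hv0 hv ((hF.dirDeriv _).slice X)]
        simp }
  refine ⟨LinearMap.toContinuousLinearMap L₀, ?_, fun ξ => rfl⟩
  obtain ⟨C, hC⟩ := hφ.exists_norm_oscParam_taylor_le h0 h1 hv0 hv hF X
  rw [hasFDerivAt_iff_isLittleO_nhds_zero]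
  refine (Asymptotics.IsBigO.of_bound C (Eventually.of_forall fun ξ => ?_)).trans_isLittleO
    (Asymptotics.isLittleO_norm_pow_id one_lt_two)
  rw [norm_pow, norm_norm]
  exact hC ξ

theorem IsCoordPhase.dirDeriv_oscParam [FiniteDimensional ℝ P]
    (hφ : IsCoordPhase v h φ) (h0 : 0 < h) (h1 : h ≤ 1)
    (hv0 : ∀ i, v i i = 0) (hv : ∀ i, ‖v i‖ ≤ 1) {F : P × E d → ℂ} (hF : SmoothBdd F) (ξ : P) :
    dirDeriv ξ (oscParam v h φ F) = oscParam v h φ (dirDeriv (ξ, 0) F) := by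
  ext X
  obtain ⟨L, hL, hL'⟩ := hφ.hasFDerivAt_oscParam h0 h1 hv0 hv hF X
  rw [dirDeriv, hL.fderiv, hL']

theorem IsCoordPhase.contDiff_oscParam [FiniteDimensional ℝ P]
    (hφ : IsCoordPhase v h φ) (h0 : 0 < h) (h1 : h ≤ 1)
    (hv0 : ∀ i, v i i = 0) (hv : ∀ i, ‖v i‖ ≤ 1) {F : P × E d → ℂ} (hF : SmoothBdd F) :
    ContDiff ℝ ∞ (oscParam v h φ F) := by
  have hd : ∀ {F : P × E d → ℂ}, SmoothBdd F → Differentiable ℝ (oscParam v h φ F) :=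
    fun hF X => by
      obtain ⟨L, hL, -⟩ := hφ.hasFDerivAt_oscParam h0 h1 hv0 hv hF X
      exact hL.differentiableAt
  rw [contDiff_infty]
  intro k
  induction k generalizing F with
  | zero => exact contDiff_zero.2 (hd hF).continuous
  | succ k ih =>
    push_cast
    -- A directional derivative is again a parameter integral with bounded smooth amplitude, so the
    -- induction must run over all `F`; finite dimension of `P` makes directional derivatives
    -- sufficient.
    rw [contDiff_succ_iff_fderiv_apply]
    refine ⟨hd hF, fun hk => absurd hk (by simp), fun ξ => ?_⟩
    have := hφ.dirDeriv_oscParam h0 h1 hv0 hv hF ξ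
    change ContDiff ℝ k (dirDeriv ξ (oscParam v h φ F))
    rw [this]
    exact ih (hF.dirDeriv _)

theorem IsCoordPhase.dirList_oscParam [FiniteDimensional ℝ P]
    (hφ : IsCoordPhase v h φ) (h0 : 0 < h) (h1 : h ≤ 1)
    (hv0 : ∀ i, v i i = 0) (hv : ∀ i, ‖v i‖ ≤ 1) {F : P × E d → ℂ} (hF : SmoothBdd F)
    (L : List P) :
    dirList L (oscParam v h φ F) = oscParam v h φ (dirList (L.map fun ξ => (ξ, 0)) F) := by
  induction L with
  | nil => rfl
  | cons ξ L ih =>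
    rw [dirList, ih, hφ.dirDeriv_oscParam h0 h1 hv0 hv (hF.dirList _)]
    rfl

end Parameters

/-! ### Gevrey classes through full derivatives, and their algebra. -/

section Gevrey

/-- The Gevrey condition in terms of the norms of the full derivatives. -/
def GevreyBdd {V : Type*} [NormedAddCommGroup V] [NormedSpace ℝ V] (s : ℝ) (f : V → ℂ) : Prop :=
  ContDiff ℝ ∞ f ∧ ∃ A C : ℝ, 0 ≤ A ∧ 1 ≤ C ∧ ∀ (k : ℕ) (x : V),
    ‖iteratedFDeriv ℝ k f x‖ ≤ A * C ^ k * (k.factorial : ℝ) ^ s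

theorem norm_multilinear_le_of_basis {d k : ℕ} (f : ContinuousMultilinearMap ℝ (fun _ : Fin k => E d) ℂ)
    {B : ℝ} (hB : ∀ r : Fin k → Fin d,
      ‖f (fun i => EuclideanSpace.single (r i) (1 : ℝ))‖ ≤ B) (hB0 : 0 ≤ B) :
    ‖f‖ ≤ (d : ℝ) ^ k * B := by
  refine f.opNorm_le_bound (by positivity) fun m => ?_
  have e : m = fun i => ∑ j, m i j • EuclideanSpace.single j (1 : ℝ) := by
    funext i
    ext j
    simp [Finset.sum_apply, Pi.single_apply]
  have e2 : f m = ∑ r : Fin k → Fin d,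
      (∏ i, m i (r i)) • f (fun i => EuclideanSpace.single (r i) (1 : ℝ)) := by
    conv_lhs => rw [e]
    rw [f.map_sum]
    exact Finset.sum_congr rfl fun r _ => f.map_smul_univ _ _
  rw [e2]
  have hterm : ∀ r ∈ (Finset.univ : Finset (Fin k → Fin d)),
      ‖(∏ i, m i (r i)) • f (fun i => EuclideanSpace.single (r i) (1 : ℝ))‖
        ≤ (∏ i, ‖m i‖) * B := by
    intro r _
    rw [norm_smul, norm_prod]
    gcongr with i
    · exact PiLp.norm_apply_le (m i) (r i)
    · exact hB r
  refine (norm_sum_le_of_le _ hterm).trans (le_of_eq ?_)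
  simp
  ring

theorem exists_multiDeriv_eq {d : ℕ} {u : E d → ℂ} (hu : ContDiff ℝ ∞ u) (k : ℕ)
    (r : Fin k → Fin d) :
    ∃ α : Fin d → ℕ, multiLength α = k ∧ ∀ x,
      iteratedFDeriv ℝ k u x (fun i => EuclideanSpace.single (r i) (1 : ℝ)) = multiDeriv α u x := by
  -- The multi-index counts how often each basis vector occurs; the tuple is then a permutation of
  -- the standard one.
  let α : Fin d → ℕ := fun i => Fintype.card {j // r j = i}
  let e : Fin k ≃ Fin (∑ i, α i) :=
    (Equiv.sigmaFiberEquiv r).symm.trans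
      ((Equiv.sigmaCongrRight fun i => Fintype.equivFin {j // r j = i}).trans finSigmaFinEquiv)
  have he : ∀ j, (finSigmaFinEquiv.symm (e j)).1 = r j := by
    intro j
    simp only [e, Equiv.trans_apply, Equiv.symm_apply_apply]
    rfl
  refine ⟨α, ?_, fun x => ?_⟩
  · have := Fintype.card_congr e
    simpa [multiLength] using this.symm
  · rw [multiDeriv, iteratedFDeriv_apply_eq_dirList hu, iteratedFDeriv_apply_eq_dirList hu]
    have hperm : (List.ofFn fun i => EuclideanSpace.single (r i) (1 : ℝ)).Perm
        (List.ofFn fun j : Fin (∑ i, α i) =>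
          EuclideanSpace.single (finSigmaFinEquiv.symm j).1 (1 : ℝ)) := by
      rw [← Multiset.coe_eq_coe, ← Fin.univ_val_map, ← Fin.univ_val_map,
        ← Multiset.map_univ_val_equiv e, Multiset.map_map]
      refine Multiset.map_congr rfl fun j _ => ?_
      simp only [Function.comp_apply, he]
    rw [dirList_perm hu hperm]

theorem multiFactorial_le {d : ℕ} (α : Fin d → ℕ) :
    multiFactorial α ≤ (multiLength α).factorial :=
  Nat.le_of_dvd (Nat.factorial_pos _) (Nat.prod_factorial_dvd_factorial_sum _ _)

theorem factorial_add_le (a b : ℕ) :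
    (a + b).factorial ≤ 2 ^ (a + b) * (a.factorial * b.factorial) := by
  rw [← Nat.add_choose_mul_factorial_mul_factorial a b, mul_assoc]
  exact Nat.mul_le_mul_right _ (Nat.choose_le_two_pow _ _)

/-- This is the return from full derivatives to multi-indices: a multinomial coefficient grows only
geometrically, each added coordinate contributing a binomial coefficient at most `2 ^ |α|`. -/
theorem factorial_multiLength_le {d : ℕ} (α : Fin d → ℕ) :
    (multiLength α).factorial ≤ (2 ^ d) ^ multiLength α * multiFactorial α := by
  have key : ∀ s : Finset (Fin d), (∑ i ∈ s, α i).factorial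
      ≤ (2 ^ s.card) ^ (∑ i ∈ s, α i) * ∏ i ∈ s, (α i).factorial := by
    intro s
    induction s using Finset.induction_on with
    | empty => simp
    | insert j s hj ih =>
      rw [Finset.sum_insert hj, Finset.prod_insert hj, Finset.card_insert_of_notMem hj]
      set a := α j
      set b := ∑ i ∈ s, α i
      calc (a + b).factorial ≤ 2 ^ (a + b) * (a.factorial * b.factorial) := factorial_add_le a b
        _ ≤ 2 ^ (a + b) * (a.factorial * ((2 ^ s.card) ^ b * ∏ i ∈ s, (α i).factorial)) := by gcongr
        _ ≤ 2 ^ (a + b) * (a.factorial * ((2 ^ s.card) ^ (a + b) *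
              ∏ i ∈ s, (α i).factorial)) := by
            gcongr
            · exact Nat.one_le_two_pow
            · lia
        _ = _ := by rw [pow_succ 2 s.card, mul_pow]; ring
  simpa [multiLength, multiFactorial] using key Finset.univ

theorem IsGevreyBounded.gevreyBdd {d : ℕ} {s : ℝ} (hs : 0 ≤ s) {u : E d → ℂ}
    (hu : IsGevreyBounded s u) : GevreyBdd s u := by
  obtain ⟨h1, A, hA, C, hC, hb⟩ := hu
  -- The factor `d` pays for the `d ^ k` basis tuples of length `k`; the maximum ensures a base at
  -- least 1, so that powers can be enlarged later.
  refine ⟨h1, A, max 1 (d * C), hA.le, le_max_left _ _, fun k x => ?_⟩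
  refine (norm_multilinear_le_of_basis _ (B := A * C ^ k * (k.factorial : ℝ) ^ s) ?_
    (by positivity)).trans ?_
  · intro r
    obtain ⟨α, hα, he⟩ := exists_multiDeriv_eq h1 k r
    rw [he]
    refine (hb α x).trans ?_
    rw [hα]
    gcongr
    rw [← hα]
    exact_mod_cast multiFactorial_le α
  · calc (d : ℝ) ^ k * (A * C ^ k * (k.factorial : ℝ) ^ s)
        = A * (d * C) ^ k * (k.factorial : ℝ) ^ s := by rw [mul_pow]; ring
      _ ≤ _ := by
        gcongr
        exact le_max_right _ _

variable {V : Type*} [NormedAddCommGroup V] [NormedSpace ℝ V] {s : ℝ}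

namespace GevreyBdd

theorem smoothBdd {f : V → ℂ} (hf : GevreyBdd s f) : SmoothBdd f := by
  obtain ⟨h1, A, C, hA, hC, hb⟩ := hf
  exact ⟨h1, fun K => ⟨_, fun x => Finset.sum_le_sum fun k _ => hb k x⟩⟩

theorem add {f g : V → ℂ} (hf : GevreyBdd s f) (hg : GevreyBdd s g) :
    GevreyBdd s (fun x => f x + g x) := by
  obtain ⟨h1, A, C, hA, hC, hb⟩ := hf
  obtain ⟨h2, B, D, hB, hD, hb'⟩ := hg
  refine ⟨h1.add h2, A + B, max C D, by positivity, hC.trans (le_max_left _ _), fun k x => ?_⟩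
  have e : iteratedFDeriv ℝ k (fun x => f x + g x) x
      = iteratedFDeriv ℝ k f x + iteratedFDeriv ℝ k g x :=
    iteratedFDeriv_add_apply (h1.contDiffAt.of_le (mod_cast le_top))
      (h2.contDiffAt.of_le (mod_cast le_top))
  rw [e, add_mul, add_mul]
  refine (norm_add_le _ _).trans (add_le_add ((hb k x).trans ?_) ((hb' k x).trans ?_))
  · gcongr; exact le_max_left _ _
  · gcongr; exact le_max_right _ _

theorem const (c : ℂ) : GevreyBdd s (fun _ : V => c) := by
  refine ⟨contDiff_const, ‖c‖, 1, norm_nonneg _, le_rfl, fun k x => ?_⟩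
  cases k with
  | zero => simp
  | succ k =>
    rw [iteratedFDeriv_const_of_ne (by lia)]
    simp only [Pi.zero_apply, norm_zero]
    positivity

/-- In the Leibniz formula `i! (k - i)! ≤ k!` controls each term, and the binomial coefficients add
up to `2 ^ k`, absorbed by the base. -/
theorem mul (hs : 1 ≤ s) {f g : V → ℂ} (hf : GevreyBdd s f) (hg : GevreyBdd s g) :
    GevreyBdd s (fun x => f x * g x) := by
  obtain ⟨h1, A, C, hA, hC, hb⟩ := hf
  obtain ⟨h2, B, D, hB, hD, hb'⟩ := hg
  have hM : 1 ≤ max C D := hC.trans (le_max_left _ _)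
  refine ⟨h1.mul h2, A * B, 2 * max C D, by positivity, by linarith, fun k x => ?_⟩
  refine (norm_iteratedFDeriv_mul_le h1 h2 x (n := k) (mod_cast le_top)).trans ?_
  have hterm : ∀ i ∈ Finset.range (k + 1), (k.choose i : ℝ) * ‖iteratedFDeriv ℝ i f x‖ *
      ‖iteratedFDeriv ℝ (k - i) g x‖
      ≤ (k.choose i : ℝ) * (A * B * max C D ^ k * (k.factorial : ℝ) ^ s) := by
    intro i hi
    have hi : i ≤ k := by have := Finset.mem_range.1 hi; lia
    rw [mul_assoc]
    refine mul_le_mul_of_nonneg_left ?_ (Nat.cast_nonneg _)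
    calc ‖iteratedFDeriv ℝ i f x‖ * ‖iteratedFDeriv ℝ (k - i) g x‖
        ≤ (A * C ^ i * (i.factorial : ℝ) ^ s)
          * (B * D ^ (k - i) * ((k - i).factorial : ℝ) ^ s) := by
          gcongr
          · exact hb i x
          · exact hb' _ x
      _ ≤ (A * max C D ^ i * (i.factorial : ℝ) ^ s)
          * (B * max C D ^ (k - i) * ((k - i).factorial : ℝ) ^ s) := by
          gcongr
          · exact le_max_left _ _
          · exact le_max_right _ _
      _ = A * B * (max C D ^ i * max C D ^ (k - i))
          * ((i.factorial * (k - i).factorial : ℕ) : ℝ) ^ s := by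
          push_cast
          rw [Real.mul_rpow (by positivity) (by positivity)]
          ring
      _ ≤ _ := by
          rw [← pow_add, Nat.add_sub_cancel' hi]
          gcongr
          exact Nat.le_of_dvd (Nat.factorial_pos _) (Nat.factorial_mul_factorial_dvd_factorial hi)
  refine (Finset.sum_le_sum hterm).trans (le_of_eq ?_)
  rw [← Finset.sum_mul]
  have : ∑ i ∈ Finset.range (k + 1), (k.choose i : ℝ) = 2 ^ k := by
    exact_mod_cast Nat.sum_range_choose k
  rw [this, mul_pow]
  ring

theorem sub (hs : 1 ≤ s) {f g : V → ℂ} (hf : GevreyBdd s f) (hg : GevreyBdd s g) :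
    GevreyBdd s (fun x => f x - g x) := by
  have := hf.add ((const (-1)).mul hs hg)
  simpa [sub_eq_add_neg] using this

theorem prod (hs : 1 ≤ s) {ι : Type*} (t : Finset ι) {f : ι → V → ℂ}
    (hf : ∀ i, GevreyBdd s (f i)) : GevreyBdd s (fun x => ∏ i ∈ t, f i x) := by
  classical
  induction t using Finset.induction_on with
  | empty => simpa using const (V := V) (s := s) 1
  | insert j t hj ih =>
    simp only [Finset.prod_insert hj]
    exact (hf j).mul hs ih

theorem comp_clm {U : Type*} [NormedAddCommGroup U] [NormedSpace ℝ U] {f : V → ℂ}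
    (hf : GevreyBdd s f) (g : U →L[ℝ] V) : GevreyBdd s (fun x => f (g x)) := by
  obtain ⟨h1, A, C, hA, hC, hb⟩ := hf
  refine ⟨h1.comp g.contDiff, A, C * max 1 ‖g‖, hA,
    one_le_mul_of_one_le_of_one_le hC (le_max_left _ _), fun k x => ?_⟩
  have := norm_iteratedFDeriv_comp_affine_le h1 g 0 k x
  simp only [zero_add] at this
  refine this.trans ?_
  calc ‖iteratedFDeriv ℝ k f (g x)‖ * ‖g‖ ^ k
      ≤ (A * C ^ k * (k.factorial : ℝ) ^ s) * max 1 ‖g‖ ^ k := by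
        gcongr
        · exact hb k _
        · exact le_max_right _ _
    _ = _ := by rw [mul_pow]; ring

end GevreyBdd

end Gevrey

/-! ### Directions dual to the coordinates for the Moyal phase. -/

section Phase

/-- The Moyal phase in coordinates. -/
theorem moyalPhase_eq_sum {n : ℕ} (h : ℝ) (W : E ((n + n) + (n + n))) :
    moyalPhase h W = -2 / h * ∑ k : Fin n,
      (W (Fin.castAdd (n + n) (Fin.natAdd n k)) * W (Fin.natAdd (n + n) (Fin.castAdd n k))
        - W (Fin.castAdd (n + n) (Fin.castAdd n k)) * W (Fin.natAdd (n + n) (Fin.natAdd n k))) := by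
  simp only [moyalPhase, sympl, fstHalf, sndHalf, PiLp.inner_apply, RCLike.inner_apply, conj_trivial,
    ← Finset.sum_sub_distrib]
  rw [mul_div_right_comm]
  congr 1
  exact Finset.sum_congr rfl fun k _ => by ring

theorem moyalPhase_contDiff {n : ℕ} (h : ℝ) : ContDiff ℝ ∞ (moyalPhase (n := n) h) := by
  have : moyalPhase (n := n) h = _ := funext (moyalPhase_eq_sum h)
  rw [this]
  fun_prop

theorem fderiv_eq_of_forall_line {V : Type*} [NormedAddCommGroup V] [NormedSpace ℝ V] {f : V → ℝ}
    (hf : ContDiff ℝ ∞ f) {v x : V} {c : ℝ} (h : ∀ t : ℝ, f (x + t • v) = f x + t * c) :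
    fderiv ℝ f x v = c := by
  have hd : DifferentiableAt ℝ f x := (hf.differentiable (by simp)) x
  rw [← hd.lineDeriv_eq_fderiv, lineDeriv]
  simp only [h]
  simp

/-- Each coordinate occurs in exactly one product of the bilinear phase, with coefficient `±2 / h`.
The direction is therefore `±1/2` times the basis vector of its partner, which differs from `i`. The
pairs are `y` with `ζ` (sign `+`) and `η` with `z` (sign `-`); the four cases below are `y`, `η`,
`z`, `ζ`. -/
theorem exists_coord_direction {n : ℕ} (i : Fin ((n + n) + (n + n))) :
    ∃ v : E ((n + n) + (n + n)), v i = 0 ∧ ‖v‖ ≤ 1 ∧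
      ∀ (h : ℝ) W, fderiv ℝ (moyalPhase h) W v = W i / h := by
  have aux : ∀ (i j : Fin ((n + n) + (n + n))) (c : ℝ), |c| ≤ 1 → i ≠ j →
      (∀ (h : ℝ) (W : E ((n + n) + (n + n))) (t : ℝ),
        moyalPhase h (W + t • c • EuclideanSpace.single j (1 : ℝ))
          = moyalPhase h W + t * (W i / h)) →
      ∃ v : E ((n + n) + (n + n)), v i = 0 ∧ ‖v‖ ≤ 1 ∧
        ∀ (h : ℝ) W, fderiv ℝ (moyalPhase h) W v = W i / h := by
    intro i j c hc hij H
    refine ⟨c • EuclideanSpace.single j (1 : ℝ), by simp [hij], ?_, fun h W =>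
      fderiv_eq_of_forall_line (moyalPhase_contDiff h) (H h W)⟩
    rw [norm_smul]
    simpa using hc
  refine Fin.addCases (fun i => ?_) (fun i => ?_) i <;>
    refine Fin.addCases (fun k => ?_) (fun k => ?_) i
  · refine aux _ (Fin.natAdd (n + n) (Fin.natAdd n k)) (1 / 2) (by norm_num [abs_of_pos])
      (by have := k.isLt; simp [Fin.ext_iff]; lia) fun h W t => by
        have hk := k.isLt
        simp only [moyalPhase_eq_sum, PiLp.add_apply, PiLp.smul_apply, PiLp.single_apply,
          Fin.ext_iff, Fin.val_castAdd, Fin.val_natAdd]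
        rw [← sub_eq_iff_eq_add', ← mul_sub, ← Finset.sum_sub_distrib, Finset.sum_eq_single k]
        · split_ifs <;> first | (exfalso; lia) | (simp only [smul_eq_mul]; ring)
        · intro x _ hx
          have hx' : (x : ℕ) ≠ k := fun hxk => hx (Fin.ext hxk)
          have hxn := x.isLt
          split_ifs <;> first | (exfalso; lia) | (simp only [smul_eq_mul]; ring)
        · simp
  · refine aux _ (Fin.natAdd (n + n) (Fin.castAdd n k)) (-(1 / 2)) (by norm_num [abs_of_pos])
      (by have := k.isLt; simp [Fin.ext_iff]; lia) fun h W t => by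
        have hk := k.isLt
        simp only [moyalPhase_eq_sum, PiLp.add_apply, PiLp.smul_apply, PiLp.single_apply,
          Fin.ext_iff, Fin.val_castAdd, Fin.val_natAdd]
        rw [← sub_eq_iff_eq_add', ← mul_sub, ← Finset.sum_sub_distrib, Finset.sum_eq_single k]
        · split_ifs <;> first | (exfalso; lia) | (simp only [smul_eq_mul]; ring)
        · intro x _ hx
          have hx' : (x : ℕ) ≠ k := fun hxk => hx (Fin.ext hxk)
          have hxn := x.isLt
          split_ifs <;> first | (exfalso; lia) | (simp only [smul_eq_mul]; ring)
        · simp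
  · refine aux _ (Fin.castAdd (n + n) (Fin.natAdd n k)) (-(1 / 2)) (by norm_num [abs_of_pos])
      (by have := k.isLt; simp [Fin.ext_iff]; lia) fun h W t => by
        have hk := k.isLt
        simp only [moyalPhase_eq_sum, PiLp.add_apply, PiLp.smul_apply, PiLp.single_apply,
          Fin.ext_iff, Fin.val_castAdd, Fin.val_natAdd]
        rw [← sub_eq_iff_eq_add', ← mul_sub, ← Finset.sum_sub_distrib, Finset.sum_eq_single k]
        · split_ifs <;> first | (exfalso; lia) | (simp only [smul_eq_mul]; ring)
        · intro x _ hx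
          have hx' : (x : ℕ) ≠ k := fun hxk => hx (Fin.ext hxk)
          have hxn := x.isLt
          split_ifs <;> first | (exfalso; lia) | (simp only [smul_eq_mul]; ring)
        · simp
  · refine aux _ (Fin.castAdd (n + n) (Fin.castAdd n k)) (1 / 2) (by norm_num [abs_of_pos])
      (by have := k.isLt; simp [Fin.ext_iff]; lia) fun h W t => by
        have hk := k.isLt
        simp only [moyalPhase_eq_sum, PiLp.add_apply, PiLp.smul_apply, PiLp.single_apply,
          Fin.ext_iff, Fin.val_castAdd, Fin.val_natAdd]
        rw [← sub_eq_iff_eq_add', ← mul_sub, ← Finset.sum_sub_distrib, Finset.sum_eq_single k]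
        · split_ifs <;> first | (exfalso; lia) | (simp only [smul_eq_mul]; ring)
        · intro x _ hx
          have hx' : (x : ℕ) ≠ k := fun hxk => hx (Fin.ext hxk)
          have hxn := x.isLt
          split_ifs <;> first | (exfalso; lia) | (simp only [smul_eq_mul]; ring)
        · simp

end Phase

/-! ### A global smooth substitute for `1 / t`. -/

section Reciprocal

/-- A smooth function with bounded derivatives which is `1 / t` away from the origin. -/
theorem exists_smoothBdd_inv {δ : ℝ} (hδ : 0 < δ) :
    ∃ q : ℝ → ℂ, SmoothBdd q ∧ ∀ t : ℝ, δ ≤ |t| → (t : ℂ) * q t = 1 := by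
  let β : ContDiffBump (0 : ℝ) := ⟨δ / 2, δ, by positivity, by linarith⟩
  have hβc : ContDiff ℝ ∞ (fun t => ((β t : ℝ) : ℂ)) := Complex.ofRealCLM.contDiff.comp β.contDiff
  have hβs : HasCompactSupport (fun t => ((β t : ℝ) : ℂ)) :=
    β.hasCompactSupport.comp_left (g := fun t : ℝ => (t : ℂ)) Complex.ofReal_zero
  have hβ1 : ∀ t : ℝ, |t| ≤ δ / 2 → β t = 1 := fun t ht =>
    β.one_of_mem_closedBall (by simpa using ht)
  have hβ0 : ∀ t : ℝ, δ ≤ |t| → β t = 0 := fun t ht =>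
    β.zero_of_le_dist (by simpa using ht)
  let q : ℝ → ℂ := fun t => (1 - (β t : ℂ)) * (t : ℂ)⁻¹
  have hqmul : ∀ t : ℝ, (t : ℂ) * q t = 1 - (β t : ℂ) := by
    intro t
    rcases eq_or_ne t 0 with rfl | ht
    · simp [hβ1 0 (by simp; positivity)]
    · have : (t : ℂ) ≠ 0 := by exact_mod_cast ht
      simp only [q]
      field_simp
  have hqc : ContDiff ℝ ∞ q := by
    rw [contDiff_iff_contDiffAt]
    intro t
    rcases eq_or_ne t 0 with rfl | ht
    · have : q =ᶠ[nhds 0] fun _ => 0 := by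
        filter_upwards [Metric.closedBall_mem_nhds (0 : ℝ) (half_pos hδ)] with t ht
        simp [q, hβ1 t (by simpa using ht)]
      exact contDiffAt_const.congr_of_eventuallyEq this
    · exact (contDiff_const.sub hβc).contDiffAt.mul
        (Complex.ofRealCLM.contDiff.contDiffAt.inv (by simpa using ht))
  refine ⟨q, ?_, fun t ht => by rw [hqmul, hβ0 t ht]; simp⟩
  -- Where `q` is exactly `1 / t` the equation `q' = -q²` holds, so the defect `r` has compact
  -- support and the Riccati criterion applies.
  let r : ℝ → ℂ := fun t => deriv q t + q t * q t
  have hqd : ContDiff ℝ ∞ (deriv q) := (contDiff_infty_iff_deriv.1 hqc).2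
  have hrs : HasCompactSupport r := by
    refine HasCompactSupport.intro (isCompact_closedBall (0 : ℝ) δ) fun t ht => ?_
    have ht : δ < |t| := by simpa using ht
    have ht0 : (t : ℂ) ≠ 0 := by
      have : t ≠ 0 := abs_pos.1 (hδ.trans ht)
      exact_mod_cast this
    have hev : q =ᶠ[nhds t] fun t : ℝ => (t : ℂ)⁻¹ := by
      filter_upwards [(isOpen_lt continuous_const continuous_abs).mem_nhds ht] with u hu
      have hu : δ < |u| := hu
      simp [q, hβ0 u hu.le]
    have hd : HasDerivAt (fun t : ℝ => (t : ℂ)⁻¹) (-1 / (t : ℂ) ^ 2) t :=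
      (Complex.ofRealCLM.hasDerivAt (x := t)).fun_inv ht0
    simp only [r]
    rw [hev.deriv_eq, hd.deriv, hev.eq_of_nhds]
    field_simp
    simp
  refine SmoothBdd.of_riccati (r := r) (M := 4 / δ) hqc
    (SmoothBdd.of_hasCompactSupport (hqd.add (hqc.mul hqc)) hrs) (-1) (fun t => ?_) fun t => ?_
  · rcases le_or_gt |t| (δ / 2) with ht | ht
    · simp [q, hβ1 t ht]; positivity
    · have h1 : ‖(1 - (β t : ℂ))‖ ≤ 1 := by
        have : (1 - (β t : ℂ)) = ((1 - β t : ℝ) : ℂ) := by push_cast; rfl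
        rw [this, Complex.norm_real, Real.norm_eq_abs, abs_le]
        constructor <;> linarith [β.nonneg (x := t), β.le_one (x := t)]
      have h2 : ‖(t : ℂ)⁻¹‖ ≤ 2 / δ := by
        rw [norm_inv, Complex.norm_real, Real.norm_eq_abs]
        refine (inv_anti₀ (by positivity) ht.le).trans (le_of_eq ?_)
        field_simp
      calc ‖q t‖ = ‖(1 - (β t : ℂ))‖ * ‖(t : ℂ)⁻¹‖ := norm_mul _ _
        _ ≤ 1 * (2 / δ) := by gcongr
        _ ≤ 4 / δ := by rw [one_mul]; gcongr; norm_num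
  · simp only [r]; ring

end Reciprocal

/-! ### Persistence of vanishing under differentiation. -/

section Vanishing

variable {V : Type*} [NormedAddCommGroup V] [NormedSpace ℝ V]

theorem dirList_eq_zero_of_isOpen {U : Set V} (hU : IsOpen U) {F : V → ℂ} (hF : ∀ x ∈ U, F x = 0)
    (L : List V) : ∀ x ∈ U, dirList L F x = 0 := by
  induction L with
  | nil => exact hF
  | cons w L ih =>
    intro x hx
    have : dirList L F =ᶠ[nhds x] fun _ => 0 :=
      Filter.eventually_of_mem (hU.mem_nhds hx) ih
    rw [dirList, dirDeriv, this.fderiv_eq]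
    simp

end Vanishing

/-! ### Integration by parts any number of times in one coordinate. -/

section RepeatedIntegration

variable {d : ℕ} {v : Fin d → E d} {h : ℝ} {φ : E d → ℝ}

theorem dirDeriv_comp_coord_eq_zero {Q : ℝ → ℂ} (hQ : ContDiff ℝ ∞ Q) {i : Fin d} {w : E d}
    (hw : w i = 0) (W : E d) : dirDeriv w (fun W => Q (W i)) W = 0 := by
  have h1 : HasFDerivAt (fun W : E d => Q (W i)) _ W :=
    ((hQ.differentiable (by simp)) (W i)).hasFDerivAt.comp W
      ((EuclideanSpace.proj i : E d →L[ℝ] ℝ).hasFDerivAt)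
  rw [dirDeriv, h1.fderiv]
  simp [hw]

theorem SmoothBdd.comp_coord {Q : ℝ → ℂ} (hQ : SmoothBdd Q) (i : Fin d) :
    SmoothBdd (fun W : E d => Q (W i)) :=
  hQ.comp_clm (EuclideanSpace.proj i : E d →L[ℝ] ℝ)

/-- Two facts permit iteration: the derivatives of `g` still vanish for `|W i| < δ`, so `q` inverts
`W i` on their support, and `∂_{v i}` annihilates `q (W i)`, so no derivative ever falls on the
accumulated powers of `q`. -/
theorem IsCoordPhase.oscVal_eq_dirList (hφ : IsCoordPhase v h φ) (h0 : 0 < h) (h1 : h ≤ 1)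
    (hv0 : ∀ i, v i i = 0) (hv : ∀ i, ‖v i‖ ≤ 1) (i : Fin d) {g : E d → ℂ} (hg : SmoothBdd g)
    {q : ℝ → ℂ} (hq : SmoothBdd q) {δ : ℝ} (hqδ : ∀ t : ℝ, δ ≤ |t| → (t : ℂ) * q t = 1)
    (hgδ : ∀ W : E d, |W i| < δ → g W = 0) (N : ℕ) :
    oscVal v h φ g = (Complex.I * h) ^ N *
      oscVal v h φ (fun W => q (W i) ^ N * dirList (List.replicate N (v i)) g W) := by
  induction N with
  | zero => simp [dirList]
  | succ N ih =>
    have hU : IsOpen {W : E d | |W i| < δ} := isOpen_lt (by fun_prop) continuous_const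
    have hD := hg.dirList (List.replicate N (v i))
    have hqN := (hq.pow N).comp_coord i
    have hqN' := (hq.pow (N + 1)).comp_coord i
    rw [ih, hφ.oscVal_eq_dirDeriv h0 h1 hv0 hv i (hqN.mul hD) (hq.comp_coord i) (fun W => ?_),
      pow_succ, mul_assoc]
    · congr 1
      rw [← hφ.oscVal_const_mul h0 h1 hv0 hv (hqN'.mul (hg.dirList _))]
      congr 1
      funext W
      congr 1
      have e : (fun y : E d => q (y i) * (q (y i) ^ N * dirList (List.replicate N (v i)) g y))
          = fun y => q (y i) ^ (N + 1) * dirList (List.replicate N (v i)) g y := by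
        funext y; ring
      rw [e, dirDeriv_mul hqN'.1 hD.1, dirDeriv_comp_coord_eq_zero (hq.pow (N + 1)).1 (hv0 i),
        zero_mul, zero_add]
      rfl
    · rcases lt_or_ge |W i| δ with hW | hW
      · rw [dirList_eq_zero_of_isOpen hU hgδ _ W hW]; simp
      · rw [← mul_assoc, hqδ _ hW, one_mul]

end RepeatedIntegration

/-! ### The Gevrey bound after `N` integrations and the choice of `N`. -/

section Estimate

theorem factorial_add_add_le (a b c : ℕ) :
    (a + b + c).factorial ≤ 4 ^ (a + b + c) * (a.factorial * b.factorial * c.factorial) := by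
  calc (a + b + c).factorial
      ≤ 2 ^ (a + b + c) * ((a + b).factorial * c.factorial) := factorial_add_le _ _
    _ ≤ 2 ^ (a + b + c) * ((2 ^ (a + b) * (a.factorial * b.factorial)) * c.factorial) := by
        gcongr; exact factorial_add_le _ _
    _ ≤ 2 ^ (a + b + c) * ((2 ^ (a + b + c) * (a.factorial * b.factorial)) * c.factorial) := by
        have h2 : 2 ^ (a + b) ≤ 2 ^ (a + b + c) := Nat.pow_le_pow_right (by norm_num) (by lia)
        exact Nat.mul_le_mul_left _ (Nat.mul_le_mul_right _ (Nat.mul_le_mul_right _ h2))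
    _ = _ := by
        rw [show 4 = 2 * 2 by norm_num, mul_pow]; ring

theorem norm_iteratedFDeriv_slice_le {P : Type*} [NormedAddCommGroup P] [NormedSpace ℝ P] {d : ℕ}
    {F : P × E d → ℂ} (hF : ContDiff ℝ ∞ F) (k : ℕ) (X : P) (W : E d) :
    ‖iteratedFDeriv ℝ k (fun W => F (X, W)) W‖ ≤ ‖iteratedFDeriv ℝ k F (X, W)‖ := by
  have hn : ‖ContinuousLinearMap.inr ℝ P (E d)‖ ≤ 1 :=
    ContinuousLinearMap.opNorm_le_bound _ zero_le_one fun W => by simp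
  have := norm_iteratedFDeriv_comp_affine_le hF (ContinuousLinearMap.inr ℝ P (E d)) (X, 0) k W
  rw [slice_eq]
  refine this.trans ?_
  simp only [ContinuousLinearMap.inr_apply, Prod.mk_add_mk, add_zero, zero_add]
  exact mul_le_of_le_one_right (norm_nonneg _) (pow_le_one₀ (norm_nonneg _) hn)

/-- An oscillatory integral with a Gevrey amplitude that vanishes where one of the coordinates is
small can be integrated by parts any number of times, with Gevrey control. -/
theorem GevreyBdd.exists_norm_oscParam_le {P : Type*} [NormedAddCommGroup P] [NormedSpace ℝ P]
    {d : ℕ} {v : Fin d → E d} (hv0 : ∀ i, v i i = 0) (hv : ∀ i, ‖v i‖ ≤ 1) {s : ℝ} (hs : 0 ≤ s)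
    {F : P × E d → ℂ} (hF : GevreyBdd s F) (i : Fin d) {δ : ℝ} (hδ : 0 < δ)
    (hFδ : ∀ p : P × E d, |p.2 i| < δ → F p = 0) :
    ∃ B D : ℝ, 0 ≤ B ∧ 1 ≤ D ∧ ∀ (h : ℝ) (φ : E d → ℝ), IsCoordPhase v h φ → 0 < h → h ≤ 1 →
      ∀ (L : List P), (∀ ξ ∈ L, ‖ξ‖ ≤ 1) → ∀ (X : P) (N : ℕ),
        ‖oscParam v h φ (dirList (L.map fun ξ => (ξ, 0)) F) X‖
          ≤ B * D ^ L.length * (L.length.factorial : ℝ) ^ s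
            * (D ^ N * (N.factorial : ℝ) ^ s * h ^ N) := by
  have hFs := hF.smoothBdd
  obtain ⟨h1, A, C, hA, hC, hb⟩ := hF
  obtain ⟨q, hq, hqδ⟩ := exists_smoothBdd_inv hδ
  obtain ⟨C₀, hC₀, hosc⟩ := exists_norm_oscVal_le hv
  set K := oscOrder d
  have hqi : SmoothBdd (fun W : E d => q (W i)) := hq.comp_coord i
  obtain ⟨Q, hQ⟩ := hqi.2 K
  set Q' : ℝ := 2 ^ (K + 1) * max Q 1 with hQ'
  have hQ'1 : 1 ≤ Q' := one_le_mul_of_one_le_of_one_le (one_le_pow₀ one_le_two) (le_max_right _ _)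
  have h4 : (1 : ℝ) ≤ 4 ^ s := Real.one_le_rpow (by norm_num) hs
  set D₁ : ℝ := C * 4 ^ s with hD₁
  have hD₁1 : 1 ≤ D₁ := one_le_mul_of_one_le_of_one_le hC h4
  refine ⟨C₀ * (2 ^ (K + 1) * ((K + 1) * (A * D₁ ^ K * (K.factorial : ℝ) ^ s))), Q' * D₁,
    by positivity, one_le_mul_of_one_le_of_one_le hQ'1 hD₁1, fun h φ hφ h0 hh1 L hL X N => ?_⟩
  set L' : List (P × E d) := L.map fun ξ => (ξ, 0)
  have hL' : ∀ w ∈ L', ‖w‖ ≤ 1 := by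
    intro w hw
    obtain ⟨ξ, hξ, rfl⟩ := List.mem_map.1 hw
    simpa using hL ξ hξ
  have hlen : L'.length = L.length := by simp [L']
  set a := L.length
  set g : E d → ℂ := fun W => dirList L' F (X, W) with hg_def
  have hg : SmoothBdd g := (hFs.dirList L').slice X
  have hU : IsOpen {p : P × E d | |p.2 i| < δ} :=
    isOpen_lt (by fun_prop) continuous_const
  have hgδ : ∀ W : E d, |W i| < δ → g W = 0 := fun W hW =>
    dirList_eq_zero_of_isOpen hU (fun p hp => hFδ p hp) L' (X, W) hW
  set G : E d → ℂ := dirList (List.replicate N (v i)) g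
  have hG : SmoothBdd G := hg.dirList _
  -- Three kinds of derivatives meet: at most `K` for convergence, `N` from integration by parts,
  -- `a` in the parameter. The factorial of the sum splits at a geometric cost, and the part
  -- depending on the fixed `K` goes into the constant.
  have hGb : ∀ k ≤ K, ∀ W, ‖iteratedFDeriv ℝ k G W‖
      ≤ A * D₁ ^ (K + N + a) * ((K.factorial : ℝ) ^ s * (N.factorial : ℝ) ^ s
        * (a.factorial : ℝ) ^ s) := by
    intro k hk W
    have b1 : ‖iteratedFDeriv ℝ k G W‖ ≤ ‖iteratedFDeriv ℝ (k + N) g W‖ := by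
      have := norm_iteratedFDeriv_dirList_le hg.1 (L := List.replicate N (v i))
        (fun w hw => by rw [List.eq_of_mem_replicate hw]; exact hv i) k W
      rwa [List.length_replicate] at this
    have b2 : ‖iteratedFDeriv ℝ (k + N) g W‖ ≤ ‖iteratedFDeriv ℝ (k + N + a) F (X, W)‖ := by
      refine (norm_iteratedFDeriv_slice_le (dirList_contDiff h1 L') _ X W).trans ?_
      have := norm_iteratedFDeriv_dirList_le h1 hL' (k + N) (X, W)
      rwa [hlen] at this
    refine b1.trans (b2.trans ((hb _ _).trans ?_))
    calc A * C ^ (k + N + a) * ((k + N + a).factorial : ℝ) ^ s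
        ≤ A * C ^ (K + N + a)
          * ((4 ^ (K + N + a) * (K.factorial * N.factorial * a.factorial) : ℕ) : ℝ) ^ s := by
          gcongr
          exact (Nat.factorial_le (by lia)).trans (factorial_add_add_le K N a)
      _ = A * (C ^ (K + N + a) * (4 ^ s) ^ (K + N + a)) * ((K.factorial : ℝ) ^ s
          * (N.factorial : ℝ) ^ s * (a.factorial : ℝ) ^ s) := by
          push_cast
          rw [Real.mul_rpow (by positivity) (by positivity),
            Real.mul_rpow (by positivity) (by positivity),
            Real.mul_rpow (by positivity) (by positivity), Real.rpow_pow_comm (by norm_num)]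
          ring
      _ = _ := by rw [← mul_pow]
  have hjet : ∀ W, jetNorm K (fun W => q (W i) ^ N * G W) W
      ≤ 2 ^ (K + 1) * (Q' ^ N * ((K + 1) * (A * D₁ ^ (K + N + a) * ((K.factorial : ℝ) ^ s
        * (N.factorial : ℝ) ^ s * (a.factorial : ℝ) ^ s)))) := by
    intro W
    refine (jetNorm_mul_le (hqi.pow N).1 hG.1 K W).trans ?_
    refine mul_le_mul_of_nonneg_left (mul_le_mul ?_ ?_ (jetNorm_nonneg _ _ _) (by positivity))
      (by positivity)
    · exact jetNorm_pow_le hqi.1 ((hQ W).trans (le_max_left _ _)) N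
    · exact jetNorm_le_of_forall fun k hk => hGb k hk W
  have hmain := hφ.oscVal_eq_dirList h0 hh1 hv0 hv i hg hq hqδ hgδ N
  have hnorm : ‖(Complex.I * (h : ℂ)) ^ N‖ = h ^ N := by
    rw [norm_pow, norm_mul, Complex.norm_I, one_mul, Complex.norm_real,
      Real.norm_of_nonneg h0.le]
  change ‖oscVal v h φ g‖ ≤ _
  rw [hmain, norm_mul, hnorm]
  have hval := hosc h φ h0 hh1 _ ((hqi.pow N).mul hG) _ hjet
  refine (mul_le_mul_of_nonneg_left hval (by positivity)).trans ?_
  -- A harmless factor that gives the powers `a` and `N` the same base `Q' * D₁`.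
  have hQa : (1 : ℝ) ≤ Q' ^ a := one_le_pow₀ hQ'1
  calc h ^ N * (C₀ * (2 ^ (K + 1) * (Q' ^ N * ((K + 1) * (A * D₁ ^ (K + N + a)
        * ((K.factorial : ℝ) ^ s * (N.factorial : ℝ) ^ s * (a.factorial : ℝ) ^ s))))))
      = (C₀ * (2 ^ (K + 1) * ((K + 1) * (A * D₁ ^ K * (K.factorial : ℝ) ^ s))))
        * (1 * D₁ ^ a) * (a.factorial : ℝ) ^ s
        * ((Q' * D₁) ^ N * (N.factorial : ℝ) ^ s * h ^ N) := by
        rw [pow_add, pow_add, mul_pow]; ring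
    _ ≤ (C₀ * (2 ^ (K + 1) * ((K + 1) * (A * D₁ ^ K * (K.factorial : ℝ) ^ s))))
        * (Q' ^ a * D₁ ^ a) * (a.factorial : ℝ) ^ s
        * ((Q' * D₁) ^ N * (N.factorial : ℝ) ^ s * h ^ N) := by gcongr
    _ = _ := by rw [← mul_pow]

/-- The optimal choice of the number of integrations by parts. -/
theorem exists_pow_mul_factorial_rpow_le {D s : ℝ} (hD : 1 ≤ D) (hs : 1 ≤ s) (m : ℕ) :
    ∃ C : ℝ, 0 < C ∧ ∀ h : ℝ, 0 < h → h ≤ 1 → ∃ N : ℕ,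
      D ^ N * (N.factorial : ℝ) ^ s * h ^ N
        ≤ h ^ m * (C * Real.exp (-(h ^ (-(1 / s))) / C)) := by
  have hs0 : 0 < s := by linarith
  have hD0 : 0 < D := by linarith
  -- Chosen so that `(κ * x) ^ s = 1 / (e D h)` for `x = h ^ (-1/s)`: with `N ≤ κ * x` each of the
  -- `N` factors `D * N ^ s * h` is at most `1 / e`.
  set κ : ℝ := (Real.exp 1 * D) ^ (-(1 / s)) with hκ
  have hκ0 : 0 < κ := Real.rpow_pos_of_pos (by positivity) _
  -- An integer power of `x` large enough for `h ^ m * x ^ j ≥ 1`; half of the exponent `κ * x` is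
  -- later spent on bounding `x ^ j`.
  set j : ℕ := ⌈s * m⌉₊
  set C₁ : ℝ := Real.exp 1 * ((2 / κ) ^ j * j.factorial)
  set C : ℝ := max (2 / κ) C₁
  have hC0 : 0 < C := lt_max_of_lt_left (by positivity)
  refine ⟨C, hC0, fun h h0 h1 => ?_⟩
  set x : ℝ := h ^ (-(1 / s)) with hx
  have hx1 : 1 ≤ x := Real.one_le_rpow_of_pos_of_le_one_of_nonpos h0 h1 (by
    have := one_div_pos.2 hs0; linarith)
  have hy : κ * x = (Real.exp 1 * D * h) ^ (-(1 / s)) :=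
    (Real.mul_rpow (by positivity) h0.le).symm
  have hys : (κ * x) ^ s = (Real.exp 1 * D * h)⁻¹ := by
    rw [hy, ← Real.rpow_mul (by positivity), neg_mul, one_div_mul_cancel hs0.ne', Real.rpow_neg_one]
  set N : ℕ := ⌊κ * x⌋₊
  have hN : (N : ℝ) ≤ κ * x := Nat.floor_le (by positivity)
  have hN' : κ * x < N + 1 := Nat.lt_floor_add_one _
  refine ⟨N, ?_⟩
  have hbase : D * (N : ℝ) ^ s * h ≤ Real.exp (-1) := by
    calc D * (N : ℝ) ^ s * h ≤ D * (κ * x) ^ s * h := by gcongr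
      _ = Real.exp (-1) := by rw [hys, Real.exp_neg]; field_simp
  have hpow : D ^ N * (N.factorial : ℝ) ^ s * h ^ N ≤ Real.exp (1 - κ * x) := by
    calc D ^ N * (N.factorial : ℝ) ^ s * h ^ N
        ≤ D ^ N * ((N ^ N : ℕ) : ℝ) ^ s * h ^ N := by
          gcongr
          exact Nat.factorial_le_pow N
      _ = (D * (N : ℝ) ^ s * h) ^ N := by
          have : ((N ^ N : ℕ) : ℝ) ^ s = ((N : ℝ) ^ s) ^ N := by
            push_cast
            rw [Real.rpow_pow_comm (by positivity)]
          rw [this, mul_pow, mul_pow]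
      _ ≤ Real.exp (-1) ^ N := by gcongr
      _ = Real.exp (-N) := by rw [← Real.exp_nat_mul]; ring_nf
      -- The extra `1` pays for rounding `κ * x` down to an integer.
      _ ≤ Real.exp (1 - κ * x) := by gcongr; linarith
  have hxj : 1 ≤ h ^ m * x ^ j := by
    have e : h ^ m * x ^ (s * m) = 1 := by
      rw [hx, ← Real.rpow_mul h0.le, ← Real.rpow_natCast, ← Real.rpow_add h0]
      have : (m : ℝ) + -(1 / s) * (s * m) = 0 := by field_simp; ring
      rw [this, Real.rpow_zero]
    rw [← e, ← Real.rpow_natCast x]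
    gcongr
    exact Nat.le_ceil _
  have hxj' : x ^ j ≤ (2 / κ) ^ j * j.factorial * Real.exp (κ / 2 * x) := by
    have := Real.pow_div_factorial_le_exp (κ / 2 * x) (by positivity) j
    rw [div_le_iff₀ (by positivity)] at this
    calc x ^ j = (2 / κ) ^ j * (κ / 2 * x) ^ j := by
          rw [← mul_pow]; congr 1; field_simp
      _ ≤ (2 / κ) ^ j * (Real.exp (κ / 2 * x) * j.factorial) := by gcongr
      _ = _ := by ring
  calc D ^ N * (N.factorial : ℝ) ^ s * h ^ N ≤ Real.exp (1 - κ * x) * 1 := by rwa [mul_one]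
    _ ≤ Real.exp (1 - κ * x) * (h ^ m * x ^ j) := by gcongr
    _ ≤ Real.exp (1 - κ * x) * (h ^ m * ((2 / κ) ^ j * j.factorial * Real.exp (κ / 2 * x))) := by
        gcongr
    _ = h ^ m * (C₁ * Real.exp (-(κ / 2 * x))) := by
        have : Real.exp (1 - κ * x) * Real.exp (κ / 2 * x)
            = Real.exp 1 * Real.exp (-(κ / 2 * x)) := by
          rw [← Real.exp_add, ← Real.exp_add]; ring_nf
        simp only [C₁]
        linear_combination (h ^ m * ((2 / κ) ^ j * j.factorial)) * this
    _ ≤ h ^ m * (C * Real.exp (-x / C)) := by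
        have hCx : x / C ≤ κ / 2 * x := by
          rw [div_le_iff₀ hC0]
          have : 1 ≤ κ / 2 * C := by
            calc (1 : ℝ) = κ / 2 * (2 / κ) := by field_simp
              _ ≤ κ / 2 * C := by gcongr; exact le_max_left _ _
          nlinarith
        gcongr
        · exact le_max_right _ _
        · rw [neg_div]; linarith

end Estimate

/-! ### The joint amplitude and the ordered partition by coordinates. -/

section Amplitude

/-- `fstHalf` as a continuous linear map. -/
noncomputable def fstHalfCLM (k : ℕ) : E (k + k) →L[ℝ] E k :=
  LinearMap.toContinuousLinearMap
    { toFun := fstHalf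
      map_add' := fun _ _ => rfl
      map_smul' := fun _ _ => rfl }

/-- `sndHalf` as a continuous linear map. -/
noncomputable def sndHalfCLM (k : ℕ) : E (k + k) →L[ℝ] E k :=
  LinearMap.toContinuousLinearMap
    { toFun := sndHalf
      map_add' := fun _ _ => rfl
      map_smul' := fun _ _ => rfl }

/-- The amplitude as a function of all its variables. -/
noncomputable def jointAmplitude {n : ℕ} (χ : E ((n + n) + (n + n)) → ℂ) (a b : E (n + n) → ℂ)
    (p : E (n + n) × E ((n + n) + (n + n))) : ℂ :=
  offDiagAmplitude χ a b p.1 p.2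

theorem gevreyBdd_jointAmplitude {n : ℕ} {s : ℝ} (hs : 1 ≤ s) {χ : E ((n + n) + (n + n)) → ℂ}
    {a b : E (n + n) → ℂ} (hχ : GevreyBdd s χ) (ha : GevreyBdd s a) (hb : GevreyBdd s b) :
    GevreyBdd s (jointAmplitude χ a b) := by
  let fst := ContinuousLinearMap.fst ℝ (E (n + n)) (E ((n + n) + (n + n)))
  let snd := ContinuousLinearMap.snd ℝ (E (n + n)) (E ((n + n) + (n + n)))
  exact (((GevreyBdd.const 1).sub hs (hχ.comp_clm snd)).mul hs
    (ha.comp_clm (fst + (fstHalfCLM (n + n)).comp snd))).mul hs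
    (hb.comp_clm (fst + (sndHalfCLM (n + n)).comp snd))

/-- The linear map onto a coordinate axis, scaled by `c`. -/
noncomputable def axisCLM {d : ℕ} (c : ℝ) (i : Fin d) : E d →L[ℝ] E d :=
  c • (EuclideanSpace.proj i : E d →L[ℝ] ℝ).smulRight (EuclideanSpace.single i (1 : ℝ))

theorem norm_axisCLM {d : ℕ} {c : ℝ} (hc : 0 ≤ c) (i : Fin d) (W : E d) :
    ‖axisCLM c i W‖ = c * |W i| := by
  simp [axisCLM, norm_smul, abs_of_nonneg hc]

/-- The factor supported where the `i`-th coordinate is bounded below, in an ordered partition. -/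
noncomputable def axisCutoff {d : ℕ} (χ : E d → ℂ) (c : ℝ) (i : Fin d) (W : E d) : ℂ :=
  (1 - χ (axisCLM c i W)) * ∏ j ∈ Finset.univ.filter (· < i), χ (axisCLM c j W)

theorem gevreyBdd_axisCutoff {d : ℕ} {s : ℝ} (hs : 1 ≤ s) {χ : E d → ℂ} (hχ : GevreyBdd s χ)
    (c : ℝ) (i : Fin d) : GevreyBdd s (axisCutoff χ c i) :=
  ((GevreyBdd.const 1).sub hs (hχ.comp_clm _)).mul hs
    (GevreyBdd.prod hs _ fun _ => hχ.comp_clm _)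

/-- The ordered products telescope. Building the partition from `χ` itself keeps it in the Gevrey
class without constructing any other cutoff. -/
theorem sum_axisCutoff {d : ℕ} (χ : E d → ℂ) (c : ℝ) (W : E d) :
    ∑ i, axisCutoff χ c i W = 1 - ∏ i, χ (axisCLM c i W) := by
  have := Finset.prod_one_sub_ordered Finset.univ fun i => 1 - χ (axisCLM c i W)
  simp only [sub_sub_cancel] at this
  rw [this, sub_sub_cancel]
  rfl

theorem axisCutoff_eq_zero {d : ℕ} {χ : E d → ℂ} (hχ : ∀ W, ‖W‖ ≤ 1 → χ W = 1) {c : ℝ} (hc : 0 < c)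
    (i : Fin d) {W : E d} (hW : |W i| < 1 / c) : axisCutoff χ c i W = 0 := by
  have : ‖axisCLM c i W‖ ≤ 1 := by
    rw [norm_axisCLM hc.le]
    rw [lt_div_iff₀ hc] at hW
    linarith
  rw [axisCutoff, hχ _ this]
  simp

/-- The partition misses 1 only where all the axis factors are nonzero. The support of `χ` then
forces every coordinate to be at most `1 / (d + 1)`, hence `‖W‖ ≤ 1`, where `1 - χ` vanishes. Using
`d + 1` avoids a separate case `d = 0`. -/
theorem sum_mul_axisCutoff {d : ℕ} {χ : E d → ℂ} (hχ : ∀ W, ‖W‖ ≤ 1 → χ W = 1)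
    (hs : tsupport χ ⊆ Metric.ball 0 2) (W : E d) :
    ∑ i, (1 - χ W) * axisCutoff χ (2 * (d + 1)) i W = 1 - χ W := by
  rw [← Finset.mul_sum, sum_axisCutoff]
  suffices h : (1 - χ W) * ∏ i, χ (axisCLM (2 * (d + 1)) i W) = 0 by
    rw [mul_sub, h]; ring
  by_cases h0 : ∏ i, χ (axisCLM (2 * (d + 1)) i W) = 0
  · rw [h0, mul_zero]
  have hi : ∀ i, |W i| ≤ 1 / (d + 1) := by
    intro i
    have h1 : χ (axisCLM (2 * (d + 1)) i W) ≠ 0 := fun h =>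
      h0 (Finset.prod_eq_zero (Finset.mem_univ i) h)
    have h2 := hs (subset_tsupport _ h1)
    rw [mem_ball_zero_iff, norm_axisCLM (by positivity)] at h2
    rw [le_div_iff₀ (by positivity)]
    linarith
  have hW : ‖W‖ ≤ 1 := by
    rw [← sq_le_one_iff₀ (norm_nonneg _), EuclideanSpace.real_norm_sq_eq]
    calc ∑ i, W i ^ 2 ≤ ∑ _i : Fin d, (1 / (d + 1) : ℝ) ^ 2 := by
          refine Finset.sum_le_sum fun i _ => ?_
          rw [← sq_abs]
          gcongr
          exact hi i
      _ = d * (1 / (d + 1) : ℝ) ^ 2 := by simp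
      _ ≤ 1 := by
          rw [one_div, inv_pow, ← div_eq_mul_inv, div_le_one (by positivity)]
          nlinarith [Nat.cast_nonneg (α := ℝ) d]
  rw [hχ W hW]
  simp

end Amplitude

/-! ### Assembling the remainder and the constants. -/

section Remainder

theorem dirList_const_mul_sum {V ι : Type*} [NormedAddCommGroup V] [NormedSpace ℝ V] [Fintype ι]
    {f : ι → V → ℂ} (hf : ∀ j, ContDiff ℝ ∞ (f j)) (c : ℂ) (L : List V) :
    dirList L (fun x => c * ∑ j, f j x) = fun x => c * ∑ j, dirList L (f j) x := by
  induction L with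
  | nil => rfl
  | cons w L ih =>
    have hd : ∀ j, ContDiff ℝ ∞ (dirList L (f j)) := fun j => dirList_contDiff (hf j) L
    funext x
    rw [dirList, ih, dirDeriv_const_mul (ContDiff.sum fun j _ => hd j)]
    congr 1
    simp only [dirDeriv, dirList]
    rw [fderiv_fun_sum fun j _ => (hd j).differentiable (by simp) x]
    simp

/-- The basis vectors along which the derivative of multi-index `α` is taken. -/
noncomputable def multiDirections {k : ℕ} (α : Fin k → ℕ) : List (E k) :=
  List.ofFn fun j : Fin (∑ i, α i) =>
    EuclideanSpace.single (finSigmaFinEquiv.symm j).1 (1 : ℝ)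

theorem multiDeriv_eq_dirList {k : ℕ} (α : Fin k → ℕ) {u : E k → ℂ} (hu : ContDiff ℝ ∞ u) (x : E k) :
    multiDeriv α u x = dirList (multiDirections α) u x :=
  iteratedFDeriv_apply_eq_dirList hu _ _ _

theorem length_multiDirections {k : ℕ} (α : Fin k → ℕ) :
    (multiDirections α).length = multiLength α := by
  simp [multiDirections, multiLength]

theorem norm_le_of_mem_multiDirections {k : ℕ} (α : Fin k → ℕ) :
    ∀ w ∈ multiDirections α, ‖w‖ ≤ 1 := by
  intro w hw
  obtain ⟨j, rfl⟩ := (List.mem_ofFn' _ _).1 hw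
  simp

/-- The pieces of the amplitude in the ordered partition by coordinates. -/
noncomputable def amplitudePiece {n : ℕ} (χ : E ((n + n) + (n + n)) → ℂ) (a b : E (n + n) → ℂ)
    (c : ℝ) (i : Fin ((n + n) + (n + n))) (p : E (n + n) × E ((n + n) + (n + n))) : ℂ :=
  jointAmplitude χ a b p * axisCutoff χ c i p.2

theorem gevreyBdd_amplitudePiece {n : ℕ} {s : ℝ} (hs : 1 ≤ s) {χ : E ((n + n) + (n + n)) → ℂ}
    {a b : E (n + n) → ℂ} (hχ : GevreyBdd s χ) (ha : GevreyBdd s a) (hb : GevreyBdd s b)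
    (c : ℝ) (i : Fin ((n + n) + (n + n))) : GevreyBdd s (amplitudePiece χ a b c i) := by
  have h : GevreyBdd s (fun p : E (n + n) × E ((n + n) + (n + n)) => axisCutoff χ c i p.2) :=
    (gevreyBdd_axisCutoff hs hχ c i).comp_clm
      (ContinuousLinearMap.snd ℝ (E (n + n)) (E ((n + n) + (n + n))))
  exact (gevreyBdd_jointAmplitude hs hχ ha hb).mul hs h

theorem sum_amplitudePiece {n : ℕ} {χ : E ((n + n) + (n + n)) → ℂ}
    (hχ : ∀ W, ‖W‖ ≤ 1 → χ W = 1) (hs : tsupport χ ⊆ Metric.ball 0 2) (a b : E (n + n) → ℂ)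
    (X : E (n + n)) (W : E ((n + n) + (n + n))) :
    ∑ i, amplitudePiece χ a b (2 * (((n + n) + (n + n) : ℕ) + 1)) i (X, W)
      = offDiagAmplitude χ a b X W := by
  have := sum_mul_axisCutoff hχ hs W
  simp only [amplitudePiece, jointAmplitude, offDiagAmplitude]
  conv_rhs => rw [← this]
  rw [Finset.sum_mul, Finset.sum_mul]
  exact Finset.sum_congr rfl fun i _ => by ring

theorem rChi_eq_sum {n : ℕ} {v : Fin ((n + n) + (n + n)) → E ((n + n) + (n + n))}
    (hv0 : ∀ i, v i i = 0) (hv : ∀ i, ‖v i‖ ≤ 1) {h : ℝ}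
    (hφ : IsCoordPhase v h (moyalPhase h)) (h0 : 0 < h) (h1 : h ≤ 1)
    {χ : E ((n + n) + (n + n)) → ℂ} {a b : E (n + n) → ℂ} {ι : Type*} [Fintype ι]
    {F : ι → E (n + n) × E ((n + n) + (n + n)) → ℂ} (hF : ∀ j, SmoothBdd (F j))
    (hsum : ∀ X W, ∑ j, F j (X, W) = offDiagAmplitude χ a b X W) :
    rChi χ a b h = fun X => (((Real.pi * h) ^ (n + n) : ℝ) : ℂ)⁻¹ *
      ∑ j, oscParam v h (moyalPhase h) (F j) X := by
  funext X
  obtain ⟨e1, e2⟩ := hφ.oscVal_sum h0 h1 hv0 hv Finset.univ fun j => (hF j).slice X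
  simp only [hsum] at e1 e2
  have e3 := (hφ.hasOscillatoryIntegral h0 h1 hv0 hv e1).oscillatoryIntegral_eq
  have e4 : oscillatoryIntegral (moyalPhase h) (offDiagAmplitude χ a b X) = _ := e3.trans e2
  rw [rChi, e4]
  rfl

/-- Increasing any of the constants only weakens the bound, so one `M` above `∑ B j * C j` and all
`D j`, `C j` serves every piece. -/
theorem sum_exponential_bounds {ι : Type*} [Fintype ι] {B D C : ι → ℝ} (hB : ∀ j, 0 ≤ B j)
    (hD : ∀ j, 1 ≤ D j) (hC : ∀ j, 0 < C j) :
    ∃ M : ℝ, 0 < M ∧ ∀ (k : ℕ) (x : ℝ), 0 ≤ x →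
      ∑ j, B j * D j ^ k * (C j * Real.exp (-x / C j)) ≤ M ^ (1 + k) * Real.exp (-x / M) := by
  have hBC : ∀ j, 0 ≤ B j * C j := fun j => mul_nonneg (hB j) (hC j).le
  have hD0 : ∀ j, 0 ≤ D j := fun j => zero_le_one.trans (hD j)
  set M : ℝ := 1 + ∑ j, (B j * C j + D j + C j) with hM
  have hpos : ∀ j ∈ (Finset.univ : Finset ι), 0 ≤ B j * C j + D j + C j := fun j _ =>
    add_nonneg (add_nonneg (hBC j) (hD0 j)) (hC j).le
  have hM1 : 0 < M := by
    have := Finset.sum_nonneg hpos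
    linarith
  have hsingle : ∀ j, B j * C j + D j + C j ≤ M := fun j => by
    have := Finset.single_le_sum hpos (Finset.mem_univ j)
    linarith
  have hDM : ∀ j, D j ≤ M := fun j => by linarith [hsingle j, hBC j, hC j]
  have hCM : ∀ j, C j ≤ M := fun j => by linarith [hsingle j, hBC j, hD0 j]
  have hBM : ∑ j, B j * C j ≤ M := by
    have : ∑ j, B j * C j ≤ ∑ j, (B j * C j + D j + C j) :=
      Finset.sum_le_sum fun j _ => by linarith [hD0 j, hC j]
    linarith
  refine ⟨M, hM1, fun k x hx => ?_⟩
  calc ∑ j, B j * D j ^ k * (C j * Real.exp (-x / C j))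
      ≤ ∑ j, B j * C j * (M ^ k * Real.exp (-x / M)) := by
        refine Finset.sum_le_sum fun j _ => ?_
        have h1 : D j ^ k ≤ M ^ k := pow_le_pow_left₀ (hD0 j) (hDM j) k
        have h2 : Real.exp (-x / C j) ≤ Real.exp (-x / M) := by
          rw [neg_div, neg_div]
          have := hC j
          gcongr
          exact hCM j
        calc B j * D j ^ k * (C j * Real.exp (-x / C j))
            = B j * C j * (D j ^ k * Real.exp (-x / C j)) := by ring
          _ ≤ _ := mul_le_mul_of_nonneg_left
            (mul_le_mul h1 h2 (Real.exp_pos _).le (by positivity)) (hBC j)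
    _ = (∑ j, B j * C j) * (M ^ k * Real.exp (-x / M)) := by rw [Finset.sum_mul]
    _ ≤ M * (M ^ k * Real.exp (-x / M)) := by gcongr
    _ = _ := by rw [pow_add, pow_one]; ring

end Remainder

end GevreyMoyal

theorem proposition3p7 (n : ℕ) (s : ℝ) (hs : 1 < s)
    (a b : E (n + n) → ℂ) (ha : IsGevreyBounded s a) (hb : IsGevreyBounded s b)
    (χ : E ((n + n) + (n + n)) → ℂ) (hχ : IsGevreyCompact s χ)
    (hχ_one : ∀ W : E ((n + n) + (n + n)), ‖W‖ ≤ 1 → χ W = 1)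
    (hχ_supp : tsupport χ ⊆ Metric.ball 0 2) :
    (∀ h : ℝ, 0 < h → h ≤ 1 → ∀ X : E (n + n),
      ∃ I : ℂ, HasOscillatoryIntegral (moyalPhase h) (offDiagAmplitude χ a b X) I) ∧
    (∀ h : ℝ, 0 < h → h ≤ 1 → ContDiff ℝ ∞ (rChi χ a b h)) ∧
    ∃ C : ℝ, 0 < C ∧ ∀ h : ℝ, 0 < h → h ≤ 1 → ∀ (α : Fin (n + n) → ℕ) (X : E (n + n)),
      ‖multiDeriv α (rChi χ a b h) X‖ ≤
        C ^ (1 + multiLength α) * (multiFactorial α : ℝ) ^ s * Real.exp (-(h ^ (-(1 / s))) / C) := by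
  have hs0 : 0 ≤ s := by linarith
  have haG := ha.gevreyBdd hs0
  have hbG := hb.gevreyBdd hs0
  have hχG := hχ.1.gevreyBdd hs0
  choose v hv0 hv hfd using exists_coord_direction (n := n)
  have hφ : ∀ h, IsCoordPhase v h (moyalPhase h) := fun h =>
    ⟨moyalPhase_contDiff h, fun i W => hfd i h W⟩
  set c : ℝ := 2 * (((n + n) + (n + n) : ℕ) + 1)
  have hc : 0 < c := by positivity
  set F := amplitudePiece χ a b c
  have hFG : ∀ j, GevreyBdd s (F j) := gevreyBdd_amplitudePiece hs.le hχG haG hbG c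
  have hFsum : ∀ X W, ∑ j, F j (X, W) = offDiagAmplitude χ a b X W :=
    sum_amplitudePiece hχ_one hχ_supp a b
  have hr : ∀ h, 0 < h → h ≤ 1 → rChi χ a b h = fun X =>
      (((Real.pi * h) ^ (n + n) : ℝ) : ℂ)⁻¹ * ∑ j, oscParam v h (moyalPhase h) (F j) X :=
    fun h h0 h1 => rChi_eq_sum hv0 hv (hφ h) h0 h1 (fun j => (hFG j).smoothBdd) hFsum
  have hRs : ∀ h, 0 < h → h ≤ 1 → ∀ j, ContDiff ℝ ∞ (oscParam v h (moyalPhase h) (F j)) :=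
    fun h h0 h1 j => (hφ h).contDiff_oscParam h0 h1 hv0 hv (hFG j).smoothBdd
  have hrs : ∀ h, 0 < h → h ≤ 1 → ContDiff ℝ ∞ (rChi χ a b h) := fun h h0 h1 => by
    rw [hr h h0 h1]
    exact contDiff_const.mul (ContDiff.sum fun j _ => hRs h h0 h1 j)
  refine ⟨fun h h0 h1 X => ⟨_, (hφ h).hasOscillatoryIntegral h0 h1 hv0 hv
    ((gevreyBdd_jointAmplitude hs.le hχG haG hbG).smoothBdd.slice X)⟩, hrs, ?_⟩
  have hvan : ∀ j (p : E (n + n) × E ((n + n) + (n + n))), |p.2 j| < 1 / c → F j p = 0 :=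
    fun j p hp => by
      simp only [F, amplitudePiece]
      rw [axisCutoff_eq_zero hχ_one hc j hp, mul_zero]
  choose B D hB hD hest using fun j =>
    (hFG j).exists_norm_oscParam_le hv0 hv hs0 j (one_div_pos.2 hc) (hvan j)
  choose C hC hopt using fun j => exists_pow_mul_factorial_rpow_le (hD j) hs.le (n + n)
  have h2s : (1 : ℝ) ≤ (2 ^ (n + n)) ^ s :=
    Real.one_le_rpow (one_le_pow₀ one_le_two) hs0
  obtain ⟨M, hM0, hM⟩ := sum_exponential_bounds (D := fun j => D j * (2 ^ (n + n)) ^ s) hB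
    (fun j => one_le_mul_of_one_le_of_one_le (hD j) h2s) hC
  refine ⟨M, hM0, fun h h0 h1 α X => ?_⟩
  set x : ℝ := h ^ (-(1 / s))
  set k := multiLength α
  set L := multiDirections α
  have hfac : ((k.factorial : ℕ) : ℝ) ^ s ≤ ((2 ^ (n + n)) ^ s) ^ k * (multiFactorial α : ℝ) ^ s := by
    calc ((k.factorial : ℕ) : ℝ) ^ s
        ≤ (((2 ^ (n + n)) ^ k * multiFactorial α : ℕ) : ℝ) ^ s := by
          gcongr
          exact factorial_multiLength_le α
      _ = _ := by
          push_cast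
          rw [Real.mul_rpow (by positivity) (by positivity), Real.rpow_pow_comm (by positivity)]
  have hpiece : ∀ j, ‖dirList L (oscParam v h (moyalPhase h) (F j)) X‖
      ≤ h ^ (n + n) * (multiFactorial α : ℝ) ^ s *
        (B j * (D j * (2 ^ (n + n)) ^ s) ^ k * (C j * Real.exp (-x / C j))) := by
    intro j
    obtain ⟨N, hN⟩ := hopt j h h0 h1
    have hDj : 0 ≤ D j := zero_le_one.trans (hD j)
    have hBj := hB j
    have hCj := hC j
    rw [(hφ h).dirList_oscParam h0 h1 hv0 hv (hFG j).smoothBdd]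
    refine (hest j h _ (hφ h) h0 h1 L (norm_le_of_mem_multiDirections α) X N).trans ?_
    rw [length_multiDirections]
    calc B j * D j ^ k * (k.factorial : ℝ) ^ s * (D j ^ N * (N.factorial : ℝ) ^ s * h ^ N)
        ≤ B j * D j ^ k * (((2 ^ (n + n)) ^ s) ^ k * (multiFactorial α : ℝ) ^ s)
          * (h ^ (n + n) * (C j * Real.exp (-x / C j))) := by gcongr
      _ = _ := by rw [mul_pow]; ring
  rw [multiDeriv_eq_dirList α (hrs h h0 h1), hr h h0 h1, dirList_const_mul_sum (hRs h h0 h1)]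
  have hpi : (1 : ℝ) ≤ Real.pi ^ (n + n) := one_le_pow₀ (by linarith [Real.pi_gt_three])
  have hconst : ‖(((Real.pi * h) ^ (n + n) : ℝ) : ℂ)⁻¹‖ ≤ (h ^ (n + n))⁻¹ := by
    rw [norm_inv, Complex.norm_real, Real.norm_of_nonneg (by positivity), mul_pow]
    refine inv_anti₀ (by positivity) ?_
    exact le_mul_of_one_le_left (by positivity) hpi
  rw [norm_mul]
  calc ‖(((Real.pi * h) ^ (n + n) : ℝ) : ℂ)⁻¹‖
        * ‖∑ j, dirList L (oscParam v h (moyalPhase h) (F j)) X‖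
      ≤ (h ^ (n + n))⁻¹ * ∑ j, h ^ (n + n) * (multiFactorial α : ℝ) ^ s *
        (B j * (D j * (2 ^ (n + n)) ^ s) ^ k * (C j * Real.exp (-x / C j))) := by
        gcongr
        exact norm_sum_le_of_le _ fun j _ => hpiece j
    _ = (multiFactorial α : ℝ) ^ s *
        ∑ j, B j * (D j * (2 ^ (n + n)) ^ s) ^ k * (C j * Real.exp (-x / C j)) := by
        rw [← Finset.mul_sum, ← mul_assoc, ← mul_assoc, inv_mul_cancel₀ (by positivity), one_mul]
    _ ≤ (multiFactorial α : ℝ) ^ s * (M ^ (1 + k) * Real.exp (-x / M)) := by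
        gcongr
        exact hM k x (by positivity)
    _ = _ := by ring
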